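/- **Setting.** Let $G$ be a stratified Lie group: a connected, simply connected real Lie group whose Lie algebra is a direct sum $V_1\oplus\dots\oplus V_k$ with $[V_1,V_i]=V_{i+1}$ for $i<k$ and $[V_1,V_k]=0$. Let $X_1,\dots,X_n$ be left-invariant vector fields spanning $V_1$ (so they satisfy Hörmander's condition), let $\mu$ be a right Haar measure on $G$, and let $L^p(G)=L^p(\mu)$. The sublaplacian $\mathcal L=-\sum_{j=1}^n X_j^2$ is non-negative and essentially self-adjoint on $C_c^\infty(G)\subset L^2(G)$; write $\mathcal L$ also for its closure, let $E$ be the spectral resolution of $\sqrt{\mathcal L}$, and for Borel $m$ on $[0,\infty)$ put $m(\sqrt{\mathcal L})=\int_0^\infty m(\lambda)\,dE_\lambda$. For $s\ge 0$ let $L^2_s=L^2_s(\mathbb R)$ be the $L^2$ Sobolev space of order $s$ on $\mathbb R$, with norm $\|(1+\xi^2)^{s/2}\widehat F\|_{L^2}$ (equal to $\infty$ if $F\notin L^2_s$). Let $\mathfrak s_+(\mathcal L)\in[0,\infty]$ be the infimum of all $s\in[0,\infty)$ such that for every compact $K\subset\mathbb R$ there is $C_{K,s}<\infty$ with $$\|F(\sqrt{\mathcal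 L})\|_{1\to1}\le C_{K,s}\,\|F\|_{L^2_s}$$ for all Borel measurable $F:\mathbb R\to\mathbb C$ with $\operatorname{supp}F\subset K$ (with $\inf\emptyset=\infty$ and $\infty\cdot 0=0$). For $\theta,\beta\ge0$ let $$m_{\theta,\beta}(\lambda)=\frac{e^{i\lambda^\theta}}{\lambda^{\theta\beta/2}}\,\chi(\lambda),$$ where $\chi\in C^\infty(\mathbb R)$ (real- or complex-valued) satisfies $\chi(\lambda)=0$ for $\lambda\le1$ and $\chi(\lambda)=1$ for all sufficiently large $\lambda$. **Lemma.** Let $\theta\ge0$ and $0\le\beta<2\,\mathfrak s_+(\mathcal L)$. If $1\le p\le\infty$ and $$2\,\mathfrak s_+(\mathcal L)\,\Bigl|\frac1p-\frac12\Bigr|<\frac\beta2,$$ then $m_{\theta,\beta}(\sqrt{\mathcal L})$ is bounded on $L^p(G)$: there is $C<\infty$ such that $\|m_{\theta,\beta}(\sqrt{\mathcal L})f\|_p\le C\|f\|_p$ for all $f\in L^2(G)\cap L^p(G)$. -/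

import Mathlib

open MeasureTheory Filter Topology
open scoped Manifold ContDiff ENNReal NNReal FourierTransform CompactlySupported

noncomputable section

namespace OscMult

section AbstractOperator

/-! ### Functions of `√A` for an operator `A` given by its graph on a core -/

variable {H : Type*} [NormedAddCommGroup H] [InnerProductSpace ℂ H] [CompleteSpace H]

/-- The closure, in the Hilbert space `H ⊕ H`, of the graph of an operator whose values on a core
are the pairs `(u, A u) ∈ D`. (When `D` is already a linear subspace, the span does nothing.) -/
def closedGraph (D : Set (H × H)) : Submodule ℂ (WithLp 2 (H × H)) :=
  (Submodule.span ℂ ((WithLp.toLp 2) '' D)).topologicalClosure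

instance (D : Set (H × H)) : CompleteSpace (closedGraph D) :=
  (Submodule.isClosed_topologicalClosure _).completeSpace_coe

/-- The embedding `H → H ⊕ H`, `u ↦ (u, 0)`. -/
def inlL2 : H →L[ℂ] WithLp 2 (H × H) :=
  (WithLp.prodContinuousLinearEquiv 2 ℂ H H).symm.toContinuousLinearMap ∘L
    ContinuousLinearMap.inl ℂ H H

/-- For a closed densely defined operator `A` with graph `Γ ⊆ H ⊕ H`, the corner
`H → H ⊕ H → Γ → H ⊕ H → H` of the orthogonal projection onto `Γ` is the bounded operator
`(1 + A* A)⁻¹` (von Neumann). When `A` is self-adjoint this is `(1 + A ^ 2)⁻¹`. -/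
def resolventSq (D : Set (H × H)) : H →L[ℂ] H :=
  (inlL2 (H := H)).adjoint ∘L (closedGraph D).starProjection ∘L inlL2

/-- The positive functional `φ ↦ ⟪u, φ(T) u⟫` on `C_c(ℝ)` for a bounded self-adjoint `T`. -/
def spectralFunctional (T : H →L[ℂ] H) (u : H) : C_c(ℝ, ℝ) →ₚ[ℝ] ℝ where
  toFun φ := (inner ℂ u (cfc (φ : ℝ → ℝ) T u)).re
  map_add' φ ψ := by
    have : cfc (fun x => φ x + ψ x) T = cfc (φ : ℝ → ℝ) T + cfc (ψ : ℝ → ℝ) T :=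
      cfc_add T φ ψ (φ.continuous.continuousOn) (ψ.continuous.continuousOn)
    change (inner ℂ u (cfc (fun x => φ x + ψ x) T u)).re = _
    rw [this]
    simp
  map_smul' c φ := by
    have : cfc (fun x => c • φ x) T = c • cfc (φ : ℝ → ℝ) T :=
      cfc_smul c φ T (φ.continuous.continuousOn)
    change (inner ℂ u (cfc (fun x => c • φ x) T u)).re = _
    rw [this]
    simp [inner_smul_right_eq_smul]
  monotone' φ ψ h := by
    have : cfc (φ : ℝ → ℝ) T ≤ cfc (ψ : ℝ → ℝ) T :=
      cfc_mono (fun x _ => h x) (φ.continuous.continuousOn) (ψ.continuous.continuousOn)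
    have h2 := ((ContinuousLinearMap.le_def _ _).1 this).inner_nonneg_right u
    have h3 := (Complex.le_def.1 h2).1
    simp [inner_sub_right] at h3
    exact h3

/-- The spectral measure `S ↦ ⟪u, E(S) u⟫` at `u` of the non-negative square root `√A`, where `A`
is the closure of a non-negative essentially self-adjoint operator given on a core by `D`, and `E`
is the projection-valued spectral measure of `√A`. It is the image of the spectral measure of
`(1 + A ^ 2)⁻¹`, provided by the Riesz representation theorem, under the map that inverts
`l ↦ (1 + l ^ 4)⁻¹` on `[0, ∞)`. -/
def spectralMeasureSqrt (D : Set (H × H)) (u : H) : Measure ℝ :=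
  (RealRMK.rieszMeasure (spectralFunctional (resolventSq D) u)).map
    (fun t : ℝ => √(√(t⁻¹ - 1)))

/-- `IsMultiplier D F B` says that the spectral integral `F(√A) = ∫ F dE` is a bounded operator
of `H`, equal to `B`: for every `u`, the quadratic form `⟪u, B u⟫` is the (absolutely
convergent) integral of `F` against the spectral measure `⟪u, E(·) u⟫`. -/
def IsMultiplier (D : Set (H × H)) (F : ℝ → ℂ) (B : H →L[ℂ] H) : Prop :=
  ∀ u : H, Integrable F (spectralMeasureSqrt D u) ∧
    inner ℂ u (B u) = ∫ l, F l ∂(spectralMeasureSqrt D u)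

end AbstractOperator

section LieGroup

variable {E : Type*} [NormedAddCommGroup E] [NormedSpace ℝ E]
  {G : Type*} [TopologicalSpace G] [ChartedSpace E G] [Group G]

/-- The derivative of `f : G → ℂ` along the left-invariant vector field with value `v` at `1`. -/
def leftDeriv (v : GroupLieAlgebra 𝓘(ℝ, E) G) (f : G → ℂ) (x : G) : ℂ :=
  (mfderiv 𝓘(ℝ, E) 𝓘(ℝ, ℂ) f x : TangentSpace 𝓘(ℝ, E) x →L[ℝ] ℂ) (mulInvariantVectorField v x)

/-- The sublaplacian `- ∑ j, X j ^ 2`, as a differential operator. -/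
def sublaplacian {n : ℕ} (X : Fin n → GroupLieAlgebra 𝓘(ℝ, E) G) (f : G → ℂ) (x : G) : ℂ :=
  -∑ j, leftDeriv (X j) (leftDeriv (X j) f) x

/-- The sublaplacian as an operator of `L²(μ)` with domain `C_c^∞(G)`: the set of all pairs of
classes `(f, - ∑ j, X j ^ 2 f)`, where `f` is a test function. -/
def sublaplacianGraph [MeasurableSpace G] (μ : Measure G) {n : ℕ}
    (X : Fin n → GroupLieAlgebra 𝓘(ℝ, E) G) : Set (Lp ℂ 2 μ × Lp ℂ 2 μ) :=
  {w | ∃ f : G → ℂ, ContMDiff 𝓘(ℝ, E) 𝓘(ℝ, ℂ) ∞ f ∧ HasCompactSupport f ∧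
    w.1 =ᵐ[μ] f ∧ w.2 =ᵐ[μ] sublaplacian X f}

/-- The (possibly infinite) norm `‖F(√L)‖_{p → p}`: the least `C` such that `F(√L)` is a bounded
operator of `L²` with `‖F(√L) u‖_p ≤ C ‖u‖_p` for all `u ∈ L²`. -/
def multiplierNorm [MeasurableSpace G] (μ : Measure G) {n : ℕ}
    (X : Fin n → GroupLieAlgebra 𝓘(ℝ, E) G) (p : ℝ≥0∞) (F : ℝ → ℂ) : ℝ≥0∞ :=
  sInf {C | ∃ B : Lp ℂ 2 μ →L[ℂ] Lp ℂ 2 μ, IsMultiplier (sublaplacianGraph μ X) F B ∧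
    ∀ u : Lp ℂ 2 μ, eLpNorm (B u) p μ ≤ C * eLpNorm u p μ}

open scoped Classical in
/-- The norm of the `L²` Sobolev space of order `s ≥ 0` on the real line,
`‖F‖ = ‖(1 + ξ ^ 2) ^ (s / 2) 𝓕 F‖_2`; it is `∞` if `F` does not belong to that space. -/
def sobolevNorm (s : ℝ≥0) (F : ℝ → ℂ) : ℝ≥0∞ :=
  if hF : MemLp F 2 volume then
    eLpNorm (fun ξ : ℝ => (1 + ξ ^ 2) ^ ((s : ℝ) / 2) * ‖(𝓕 (hF.toLp F) : Lp ℂ 2 volume) ξ‖)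
      2 volume
  else ∞

/-- The property of `s` in the definition of the threshold `𝔰₊(L)`: for all compact `K ⊆ ℝ` there
is `C < ∞` such that `‖F(√L)‖_{1 → 1} ≤ C ‖F‖_{L²_s}` for all Borel functions `F` supported
in `K`. -/
def HasL1Estimate [MeasurableSpace G] (μ : Measure G) {n : ℕ}
    (X : Fin n → GroupLieAlgebra 𝓘(ℝ, E) G) (s : ℝ≥0) : Prop :=
  ∀ K : Set ℝ, IsCompact K → ∃ C : ℝ≥0, ∀ F : ℝ → ℂ, Measurable F → tsupport F ⊆ K →
    multiplierNorm μ X 1 F ≤ C * sobolevNorm s F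

/-- The threshold `𝔰₊(L) ∈ [0, ∞]`, the infimum being `∞` if no `s` is admissible. -/
def sPlus [MeasurableSpace G] (μ : Measure G) {n : ℕ}
    (X : Fin n → GroupLieAlgebra 𝓘(ℝ, E) G) : ℝ≥0∞ :=
  ⨅ (s : ℝ≥0) (_ : HasL1Estimate μ X s), (s : ℝ≥0∞)

/-- The left-invariant vector fields `X j` satisfy Hörmander's condition: they generate the Lie
algebra of `G`. -/
def Hormander [FiniteDimensional ℝ E] [LieGroup 𝓘(ℝ, E) ∞ G] {n : ℕ}
    (X : Fin n → GroupLieAlgebra 𝓘(ℝ, E) G) : Prop :=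
  haveI : CompleteSpace E := FiniteDimensional.complete ℝ E
  haveI : LieGroup 𝓘(ℝ, E) (minSmoothness ℝ 3) G :=
    LieGroup.of_le (n := ∞) (by
      rw [minSmoothness_of_isRCLikeNormedField]; exact WithTop.coe_le_coe.2 le_top)
  LieSubalgebra.lieSpan ℝ (GroupLieAlgebra 𝓘(ℝ, E) G) (Set.range X) = ⊤

/-- The group `G` is stratified with the `X j` spanning the first layer.

This is expressed by the Hörmander condition and the automorphic dilations: for every `r > 0`
there is a Lie group automorphism of `G` whose differential multiplies every `X j` by `r`. For
connected `G` this is equivalent to: `G` is simply connected, and its Lie algebra is a direct sum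
`V_1 ⊕ ⋯ ⊕ V_k` with `[V_1, V_i] = V_{i + 1}` and `[V_1, V_k] = 0`, where `V_1` is the span of the
`X j`. (The dilations scale `i`-fold commutators of the `X j` by `r ^ i`, which gives the grading,
and they contract the discrete kernel of the universal covering, which must then be trivial. In the
other direction, automorphisms of the Lie algebra of a simply connected group integrate.) -/
structure IsStratified [FiniteDimensional ℝ E] [LieGroup 𝓘(ℝ, E) ∞ G] {n : ℕ}
    (X : Fin n → GroupLieAlgebra 𝓘(ℝ, E) G) : Prop where
  hormander : Hormander X
  dilation : ∀ r : ℝ, 0 < r → ∃ δ : G ≃* G,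
    ContMDiff 𝓘(ℝ, E) 𝓘(ℝ, E) ∞ δ ∧ ContMDiff 𝓘(ℝ, E) 𝓘(ℝ, E) ∞ δ.symm ∧
    ∀ (j : Fin n) (f : G → ℂ) (x : G), ContMDiff 𝓘(ℝ, E) 𝓘(ℝ, ℂ) ∞ f →
      leftDeriv (X j) (f ∘ δ) x = r * leftDeriv (X j) f (δ x)

end LieGroup

/-- The oscillating multiplier `m_{θ,β}(l) = e^{i l^θ} l^{-θβ/2} χ(l)`. -/
def oscMultiplier (χ : ℝ → ℂ) (θ β : ℝ) (l : ℝ) : ℂ :=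
  Complex.exp (Complex.I * ((l ^ θ : ℝ) : ℂ)) / ((l ^ (θ * β / 2) : ℝ) : ℂ) * χ l

end OscMult

end

set_option linter.unusedSectionVars false

/-! The multiplier is cut into dyadic frequency pieces, each of which is a dilate of an oscillating
bump at unit frequency. The piece at frequency `a` equals `R^(-β/2) e^{iσR(l/a)^θ} ψ(l/a)`, where `R
= a^θ` and `ψ` is a fixed bump in `(0, ∞)` (`truncMult_sub_truncMult`). On `L²` its norm is
`O(R^(-β/2))` by the spectral theorem. On `L¹` the group dilations remove the factor `1/a`
(`IsMultiplier.dilate_one`). What remains is supported in a fixed compact set and has Sobolev norm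
`O(R^s)` (`sobolevNorm_osc_le`), so any `s` admissible for the threshold gives the bound
`O(R^(s-β/2))`.

Interpolation for `1 < p < 2` (`eLpNorm_interpolate`) yields `O(R^(s(2/p-1)-β/2))`. The assumption
on `p` leaves room for an admissible `s` with negative exponent (`exists_hasL1Estimate_of_lt`), so
the pieces sum geometrically (`boundedMultiplier_of_lt_two`). The range `2 < p < ∞` follows by
duality, as the adjoint has the conjugate multiplier, of the same type with phase sign `-1`. The
case `p = 2` is spectral. The end points are incompatible with `β < 2 𝔰₊`. For `θ = 0` there is no
decay to sum; there the multiplier is a constant minus a smooth compactly supported function on `[0,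
∞)`.

Spectral statements are reduced to the bounded operator `T = (1 + A²)⁻¹`. A continuous `F` with
limit `F 0` at infinity becomes a continuous function of `T`, so `F(√A)` comes from the continuous
functional calculus (`isMultiplier_pullback`). A unitary scaling the closed graph of `A` conjugates
`T` into an explicit function of `T` (`conj_resolventSq`), and this gives the behaviour of `F(√A)`
under dilations. -/

namespace OscMult

/-! ### The operator `(1 + A²)⁻¹` as a corner of a projection -/

section Resolvent

variable {H : Type*} [NormedAddCommGroup H] [InnerProductSpace ℂ H] [CompleteSpace H]

lemma inlL2_apply (u : H) : inlL2 u = WithLp.toLp 2 (u, 0) := rfl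

lemma inlL2_adjoint_apply (z : WithLp 2 (H × H)) : (inlL2 (H := H)).adjoint z = z.fst := by
  refine ext_inner_right ℂ fun v => ?_
  rw [ContinuousLinearMap.adjoint_inner_left, inlL2_apply]
  simp [WithLp.prod_inner_apply]

lemma resolventSq_apply (D : Set (H × H)) (u : H) :
    resolventSq D u = ((closedGraph D).starProjection (inlL2 u)).fst := by
  simp [resolventSq, inlL2_adjoint_apply]

/-- The vector `(x, w)` is the projection of `(u, 0)` to the graph, so `(u - x, -w)` is orthogonal
to the graph. This is the weak form of `x + A*Ax = u` with `w = Ax`; with the converse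
`resolventSq_eq` it replaces computations with the unbounded operator. -/
lemma exists_resolventSq (D : Set (H × H)) (u : H) :
    ∃ w : H, WithLp.toLp 2 (resolventSq D u, w) ∈ closedGraph D ∧
      ∀ z ∈ closedGraph D, inner ℂ (u - resolventSq D u) z.fst - inner ℂ w z.snd = 0 := by
  refine ⟨((closedGraph D).starProjection (inlL2 u)).snd, ?_, fun z hz => ?_⟩
  · rw [resolventSq_apply]
    exact Submodule.starProjection_apply_mem _ _
  · have h := Submodule.starProjection_inner_eq_zero (K := closedGraph D) (inlL2 u) z hz
    rw [WithLp.prod_inner_apply] at h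
    change inner ℂ (u - ((closedGraph D).starProjection (inlL2 u)).fst) z.fst +
      inner ℂ (0 - ((closedGraph D).starProjection (inlL2 u)).snd) z.snd = 0 at h
    rwa [zero_sub, inner_neg_left, ← sub_eq_add_neg, ← resolventSq_apply] at h

lemma resolventSq_eq (D : Set (H × H)) {u x w : H} (hx : WithLp.toLp 2 (x, w) ∈ closedGraph D)
    (h : ∀ z ∈ closedGraph D, inner ℂ (u - x) z.fst - inner ℂ w z.snd = 0) :
    resolventSq D u = x := by
  have h1 : (closedGraph D).starProjection (inlL2 u) = WithLp.toLp 2 (x, w) := by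
    refine Submodule.eq_starProjection_of_mem_of_inner_eq_zero hx fun z hz => ?_
    rw [WithLp.prod_inner_apply]
    change inner ℂ (u - x) z.fst + inner ℂ (0 - w) z.snd = 0
    rw [zero_sub, inner_neg_left, ← sub_eq_add_neg]
    exact h z hz
  rw [resolventSq_apply, h1]
  rfl

lemma isSelfAdjoint_resolventSq (D : Set (H × H)) : IsSelfAdjoint (resolventSq D) := by
  rw [ContinuousLinearMap.isSelfAdjoint_iff_isSymmetric]
  intro u v
  simp only [ContinuousLinearMap.coe_coe, resolventSq, ContinuousLinearMap.comp_apply]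
  rw [ContinuousLinearMap.adjoint_inner_left, ContinuousLinearMap.adjoint_inner_right]
  exact Submodule.inner_starProjection_left_eq_right _ _ _

lemma inner_resolventSq_self (D : Set (H × H)) (u : H) :
    inner ℂ (resolventSq D u) u = ((‖(closedGraph D).starProjection (inlL2 u)‖ ^ 2 : ℝ) : ℂ) := by
  have h : inner ℂ (resolventSq D u) u =
      inner ℂ ((closedGraph D).starProjection (inlL2 u)) (inlL2 u) := by
    simp only [resolventSq, ContinuousLinearMap.comp_apply]
    rw [ContinuousLinearMap.adjoint_inner_left]
  have h2 := Submodule.starProjection_inner_eq_zero (K := closedGraph D) (inlL2 u) _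
    (Submodule.starProjection_apply_mem (closedGraph D) (inlL2 u))
  rw [inner_sub_left, sub_eq_zero] at h2
  rw [h, ← inner_conj_symm, h2, inner_self_eq_norm_sq_to_K]
  simp

lemma resolventSq_nonneg (D : Set (H × H)) : 0 ≤ resolventSq D := by
  rw [ContinuousLinearMap.nonneg_iff_isPositive, ContinuousLinearMap.isPositive_iff_complex]
  intro u
  rw [inner_resolventSq_self]
  simp only [RCLike.re_to_complex, Complex.ofReal_re]
  exact ⟨trivial, by positivity⟩

lemma resolventSq_le_one (D : Set (H × H)) : resolventSq D ≤ 1 := by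
  rw [ContinuousLinearMap.le_def, ContinuousLinearMap.isPositive_iff_complex]
  intro u
  have h1 : inner ℂ ((1 - resolventSq D) u) u =
      ((‖u‖ ^ 2 - ‖(closedGraph D).starProjection (inlL2 u)‖ ^ 2 : ℝ) : ℂ) := by
    rw [sub_apply, inner_sub_left, inner_resolventSq_self]
    simp [inner_self_eq_norm_sq_to_K]
  have h2 : ‖(closedGraph D).starProjection (inlL2 u)‖ ≤ ‖u‖ := by
    refine (Submodule.norm_starProjection_apply_le _ _).trans ?_
    rw [inlL2_apply]
    simp
  rw [h1]
  simp only [RCLike.re_to_complex, Complex.ofReal_re]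
  exact ⟨trivial, sub_nonneg.2 (by gcongr)⟩

lemma spectrum_resolventSq_subset (D : Set (H × H)) :
    spectrum ℝ (resolventSq D) ⊆ Set.Icc 0 1 := by
  intro t ht
  refine ⟨spectrum_nonneg_of_nonneg (resolventSq_nonneg D) ht, ?_⟩
  have := (le_algebraMap_iff_spectrum_le (r := (1 : ℝ)) (a := resolventSq D)
    (isSelfAdjoint_resolventSq D)).1 (by simpa using resolventSq_le_one D)
  exact this t ht

end Resolvent

/-! ### Spectral measures of a bounded operator with spectrum in `[0, 1]` -/

section SpectralMeasure

variable {H : Type*} [NormedAddCommGroup H] [InnerProductSpace ℂ H] [CompleteSpace H]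

lemma inner_cfc_real (T : H →L[ℂ] H) (f : ℝ → ℝ) (u : H) :
    inner ℂ u (cfc f T u) = ((inner ℂ u (cfc f T u)).re : ℂ) := by
  have h : IsSelfAdjoint (cfc f T) := cfc_predicate f T
  have h2 : inner ℂ (cfc f T u) u = inner ℂ u (cfc f T u) :=
    (ContinuousLinearMap.isSelfAdjoint_iff_isSymmetric.1 h) u u
  rw [eq_comm, ← Complex.conj_eq_iff_re, inner_conj_symm]
  exact h2

/-- A continuous function of compact support that is `1` on `[0, 1]`. -/
noncomputable def unitCutoff : C_c(ℝ, ℝ) where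
  toFun t := max 0 (1 - Metric.infDist t (Set.Icc 0 1))
  continuous_toFun := by
    have := Metric.continuous_infDist_pt (Set.Icc (0:ℝ) 1)
    fun_prop
  hasCompactSupport' := by
    refine HasCompactSupport.intro (K := Set.Icc (-1) 2) isCompact_Icc fun t ht => ?_
    have : 1 ≤ Metric.infDist t (Set.Icc 0 1) := by
      rw [Metric.le_infDist ⟨0, by simp⟩]
      rintro y ⟨h0, h1⟩
      rw [Real.dist_eq]
      by_contra! hlt
      rw [abs_lt] at hlt
      exact ht ⟨by linarith, by linarith⟩
    simp [this]

lemma unitCutoff_eq_one {t : ℝ} (ht : t ∈ Set.Icc (0:ℝ) 1) : unitCutoff t = 1 := by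
  change max 0 (1 - Metric.infDist t (Set.Icc 0 1)) = 1
  simp [Metric.infDist_zero_of_mem ht]

/-- The compactly supported product of the cutoff with a continuous function. -/
noncomputable def cutMul (f : ℝ → ℝ) (hf : Continuous f) : C_c(ℝ, ℝ) where
  toFun t := unitCutoff t * f t
  continuous_toFun := unitCutoff.continuous.mul hf
  hasCompactSupport' := unitCutoff.hasCompactSupport.mul_right

/-- The spectral measure at `u` of a bounded self-adjoint operator. -/
noncomputable abbrev specMeas (T : H →L[ℂ] H) (u : H) : Measure ℝ :=
  RealRMK.rieszMeasure (spectralFunctional T u)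

lemma integral_specMeas_compact (T : H →L[ℂ] H) (u : H) (φ : C_c(ℝ, ℝ)) :
    ∫ t, φ t ∂(specMeas T u) = (inner ℂ u (cfc (φ : ℝ → ℝ) T u)).re :=
  RealRMK.integral_rieszMeasure _ φ

variable {T : H →L[ℂ] H}

/-- The Riesz measure is only known through compactly supported test functions. A nonnegative one
that vanishes on the spectrum has integral zero, hence vanishes almost everywhere; truncations of
the distance to `[0, 1]` detect every outside point. -/
lemma ae_mem_Icc_specMeas (hs : spectrum ℝ T ⊆ Set.Icc 0 1) (u : H) :
    ∀ᵐ t ∂(specMeas T u), t ∈ Set.Icc (0:ℝ) 1 := by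
  let d : ℝ → ℝ := fun t => Metric.infDist t (Set.Icc 0 1)
  have hd : Continuous d := Metric.continuous_infDist_pt _
  let k : ℕ → C_c(ℝ, ℝ) := fun N =>
    { toFun := fun t => max 0 (N - |t|) * d t
      continuous_toFun := by fun_prop
      hasCompactSupport' := by
        refine HasCompactSupport.intro (K := Set.Icc (-N : ℝ) N) isCompact_Icc fun t ht => ?_
        have : (N : ℝ) ≤ |t| := by
          by_contra! h
          rw [abs_lt] at h
          exact ht ⟨h.1.le, h.2.le⟩
        simp [this] }
  have hk0 : ∀ N t, 0 ≤ k N t := fun N t =>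
    mul_nonneg (le_max_left _ _) Metric.infDist_nonneg
  have hk : ∀ N, ∀ᵐ t ∂(specMeas T u), k N t = 0 := by
    intro N
    have h1 : ∫ t, k N t ∂(specMeas T u) = 0 := by
      rw [integral_specMeas_compact]
      have : cfc (k N : ℝ → ℝ) T = 0 := by
        rw [← cfc_zero ℝ T]
        refine cfc_congr fun t ht => ?_
        change max 0 (N - |t|) * d t = 0
        simp [d, Metric.infDist_zero_of_mem (hs ht)]
      simp [this]
    have := (integral_eq_zero_iff_of_nonneg (hk0 N)
      ((k N).continuous.integrable_of_hasCompactSupport (k N).hasCompactSupport)).1 h1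
    exact this
  filter_upwards [ae_all_iff.2 hk] with t ht
  obtain ⟨N, hN⟩ := exists_nat_gt |t|
  have h1 : max 0 (N - |t|) * d t = 0 := ht N
  have h2 : max 0 ((N : ℝ) - |t|) ≠ 0 := by
    rw [max_eq_right (by linarith)]
    linarith
  have h3 : d t = 0 := (mul_eq_zero.1 h1).resolve_left h2
  exact (isClosed_Icc.mem_iff_infDist_zero ⟨0, by simp⟩).2 h3

lemma integral_specMeas (hs : spectrum ℝ T ⊆ Set.Icc 0 1) (u : H) {f : ℝ → ℝ}
    (hf : Continuous f) : Integrable f (specMeas T u) ∧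
      ∫ t, f t ∂(specMeas T u) = (inner ℂ u (cfc f T u)).re := by
  have h1 : (cutMul f hf : ℝ → ℝ) =ᵐ[specMeas T u] f := by
    filter_upwards [ae_mem_Icc_specMeas hs u] with t ht
    change unitCutoff t * f t = f t
    simp [unitCutoff_eq_one ht]
  have h2 : cfc (cutMul f hf : ℝ → ℝ) T = cfc f T := by
    refine cfc_congr fun t ht => ?_
    change unitCutoff t * f t = f t
    simp [unitCutoff_eq_one (hs ht)]
  constructor
  · exact ((cutMul f hf).continuous.integrable_of_hasCompactSupport
      (cutMul f hf).hasCompactSupport).congr h1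
  · rw [← integral_congr_ae h1, integral_specMeas_compact, h2]

lemma isFiniteMeasure_specMeas (hs : spectrum ℝ T ⊆ Set.Icc 0 1) (u : H) :
    IsFiniteMeasure (specMeas T u) :=
  ((integrable_const_iff (c := (1:ℝ))).1
    (integral_specMeas hs u continuous_const).1).resolve_left one_ne_zero

/-- The operator `g(T)`, for `T` self-adjoint and `g` complex-valued. -/
noncomputable def fcalc (T : H →L[ℂ] H) (g : ℝ → ℂ) : H →L[ℂ] H :=
  cfc (fun t => (g t).re) T + Complex.I • cfc (fun t => (g t).im) T

lemma integral_specMeas_complex (hs : spectrum ℝ T ⊆ Set.Icc 0 1) (u : H) {g : ℝ → ℂ}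
    (hg : Continuous g) : Integrable g (specMeas T u) ∧
      inner ℂ u (fcalc T g u) = ∫ t, g t ∂(specMeas T u) := by
  obtain ⟨i1, e1⟩ := integral_specMeas hs u (Complex.continuous_re.comp hg)
  obtain ⟨i2, e2⟩ := integral_specMeas hs u (Complex.continuous_im.comp hg)
  have hi : Integrable g (specMeas T u) := by
    have := i1.ofReal (𝕜 := ℂ) |>.add ((i2.ofReal (𝕜 := ℂ)).const_mul Complex.I)
    refine this.congr (ae_of_all _ fun t => ?_)
    simp [mul_comm Complex.I, Complex.re_add_im]
  refine ⟨hi, ?_⟩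
  rw [← integral_re_add_im hi]
  simp only [fcalc, add_apply, smul_apply, inner_add_right,
    inner_smul_right]
  rw [inner_cfc_real T (fun t => (g t).re), inner_cfc_real T (fun t => (g t).im)]
  simp only [Function.comp_def] at e1 e2
  rw [← e1, ← e2]
  simp [mul_comm]

end SpectralMeasure

end OscMult

namespace OscMult

/-! ### Complex functions of a self-adjoint operator -/

section FunctionalCalculus

variable {H : Type*} [NormedAddCommGroup H] [InnerProductSpace ℂ H] [CompleteSpace H]
  {T : H →L[ℂ] H}

lemma fcalc_congr {g g' : ℝ → ℂ} (h : Set.EqOn g g' (spectrum ℝ T)) : fcalc T g = fcalc T g' := by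
  unfold fcalc
  rw [cfc_congr (a := T) (f := fun t => (g t).re) (g := fun t => (g' t).re)
      fun t ht => congrArg Complex.re (h ht),
    cfc_congr (a := T) (f := fun t => (g t).im) (g := fun t => (g' t).im)
      fun t ht => congrArg Complex.im (h ht)]

lemma norm_fcalc_le {g : ℝ → ℂ} {c : ℝ} (hc : 0 ≤ c) (h : ∀ t ∈ spectrum ℝ T, ‖g t‖ ≤ c) :
    ‖fcalc T g‖ ≤ 2 * c := by
  have h1 : ‖cfc (fun t => (g t).re) T‖ ≤ c :=
    norm_cfc_le hc fun t ht => (Complex.abs_re_le_norm _).trans (h t ht)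
  have h2 : ‖cfc (fun t => (g t).im) T‖ ≤ c :=
    norm_cfc_le hc fun t ht => (Complex.abs_im_le_norm _).trans (h t ht)
  calc ‖fcalc T g‖ ≤ _ := norm_add_le _ _
    _ ≤ c + c := by
        rw [norm_smul, Complex.norm_I, one_mul]
        gcongr
    _ = 2 * c := by ring

lemma fcalc_comp (hT : IsSelfAdjoint T) {g : ℝ → ℂ} (hg : Continuous g) {h : ℝ → ℝ}
    (hh : ContinuousOn h (spectrum ℝ T)) : fcalc (cfc h T) g = fcalc T (g ∘ h) := by
  unfold fcalc
  rw [← cfc_comp (fun t => (g t).re) h T hT (Complex.continuous_re.comp hg).continuousOn hh,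
    ← cfc_comp (fun t => (g t).im) h T hT (Complex.continuous_im.comp hg).continuousOn hh]
  rfl

lemma conj_fcalc (hT : IsSelfAdjoint T) (U : H ≃ₗᵢ[ℂ] H) {g : ℝ → ℂ} (hg : Continuous g) :
    U.conjStarAlgEquiv (fcalc T g) = fcalc (U.conjStarAlgEquiv T) g := by
  have hc : Continuous U.conjStarAlgEquiv := by
    have : (U.conjStarAlgEquiv : (H →L[ℂ] H) → (H →L[ℂ] H)) = fun x =>
        (U : H →L[ℂ] H) ∘L x ∘L (U.symm : H →L[ℂ] H) := by
      ext x : 1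
      exact U.conjStarAlgEquiv_apply x
    rw [this]
    fun_prop
  have hT' : IsSelfAdjoint (U.conjStarAlgEquiv T) := hT.map U.conjStarAlgEquiv
  unfold fcalc
  rw [map_add, map_smul,
    StarAlgHomClass.map_cfc (S := ℂ) U.conjStarAlgEquiv (fun t => (g t).re) T
      (Complex.continuous_re.comp hg).continuousOn hc hT hT',
    StarAlgHomClass.map_cfc (S := ℂ) U.conjStarAlgEquiv (fun t => (g t).im) T
      (Complex.continuous_im.comp hg).continuousOn hc hT hT']

end FunctionalCalculus

/-! ### Spectral multipliers as functions of `(1 + A²)⁻¹` -/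

section Multiplier

variable {H : Type*} [NormedAddCommGroup H] [InnerProductSpace ℂ H] [CompleteSpace H]
  {D : Set (H × H)}

/-- Over `ℂ`, polarization recovers an operator from its quadratic form. -/
lemma IsMultiplier.unique {F : ℝ → ℂ} {B B' : H →L[ℂ] H} (h : IsMultiplier D F B)
    (h' : IsMultiplier D F B') : B = B' := by
  have : (B : H →ₗ[ℂ] H) = B' := by
    refine (ext_inner_map _ _).1 fun u => ?_
    have := congrArg (starRingEnd ℂ) ((h u).2.trans (h' u).2.symm)
    rwa [inner_conj_symm, inner_conj_symm] at this
  exact ContinuousLinearMap.coe_injective this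

lemma IsMultiplier.add {F F' : ℝ → ℂ} {B B' : H →L[ℂ] H} (h : IsMultiplier D F B)
    (h' : IsMultiplier D F' B') : IsMultiplier D (fun l => F l + F' l) (B + B') := fun u =>
  ⟨(h u).1.add (h' u).1, by
    rw [integral_add (h u).1 (h' u).1, ← (h u).2, ← (h' u).2, add_apply, inner_add_right]⟩

lemma IsMultiplier.const_smul {F : ℝ → ℂ} {B : H →L[ℂ] H} (c : ℂ) (h : IsMultiplier D F B) :
    IsMultiplier D (fun l => c * F l) (c • B) := fun u =>
  ⟨(h u).1.const_mul c, by
    rw [integral_const_mul, ← (h u).2, smul_apply, inner_smul_right]⟩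

lemma IsMultiplier.adjoint {F : ℝ → ℂ} {B : H →L[ℂ] H} (h : IsMultiplier D F B) :
    IsMultiplier D (fun l => starRingEnd ℂ (F l)) B.adjoint := fun u =>
  ⟨((RCLike.conjCLE (K := ℂ)).toContinuousLinearMap.integrable_comp (h u).1), by
    rw [ContinuousLinearMap.adjoint_inner_right, ← inner_conj_symm, (h u).2, integral_conj]⟩

/-- The inverse of `l ↦ (1 + l ^ 4)⁻¹` on `[0, ∞)`. -/
noncomputable def invParam (t : ℝ) : ℝ := √(√(t⁻¹ - 1))

lemma measurable_invParam : Measurable invParam := by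
  unfold invParam
  fun_prop

lemma spectralMeasureSqrt_eq (u : H) :
    spectralMeasureSqrt D u = (specMeas (resolventSq D) u).map invParam := rfl

lemma ae_nonneg_spectralMeasureSqrt (u : H) : ∀ᵐ l ∂(spectralMeasureSqrt D u), 0 ≤ l := by
  rw [spectralMeasureSqrt_eq, ae_map_iff measurable_invParam.aemeasurable measurableSet_Ici]
  exact ae_of_all _ fun t => Real.sqrt_nonneg _

lemma IsMultiplier.congr {F F' : ℝ → ℂ} {B : H →L[ℂ] H} (h : IsMultiplier D F B)
    (hF : ∀ l, 0 ≤ l → F l = F' l) : IsMultiplier D F' B := fun u => by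
  have h1 : F =ᵐ[spectralMeasureSqrt D u] F' :=
    (ae_nonneg_spectralMeasureSqrt u).mono fun l hl => hF l hl
  exact ⟨(h u).1.congr h1, by rw [← integral_congr_ae h1, (h u).2]⟩

lemma isMultiplier_of_ae {F q : ℝ → ℂ} (hF : Measurable F) {B : H →L[ℂ] H}
    (h : ∀ u, F ∘ invParam =ᵐ[specMeas (resolventSq D) u] q)
    (hq : ∀ u, Integrable q (specMeas (resolventSq D) u) ∧
      inner ℂ u (B u) = ∫ t, q t ∂(specMeas (resolventSq D) u)) : IsMultiplier D F B := fun u => by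
  rw [spectralMeasureSqrt_eq, integrable_map_measure hF.aestronglyMeasurable
    measurable_invParam.aemeasurable, integral_map measurable_invParam.aemeasurable
    hF.aestronglyMeasurable]
  refine ⟨(hq u).1.congr (h u).symm, ?_⟩
  rw [(hq u).2]
  exact integral_congr_ae (h u).symm

lemma isMultiplier_one : IsMultiplier D (fun _ => 1) (1 : H →L[ℂ] H) := by
  refine isMultiplier_of_ae (q := fun _ => 1) measurable_const
    (fun u => ae_of_all _ fun t => rfl) fun u => ?_
  have h := integral_specMeas_complex (spectrum_resolventSq_subset D) u
    (g := fun _ => (1:ℂ)) continuous_const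
  have h1 : fcalc (resolventSq D) (fun _ => (1:ℂ)) = 1 := by
    simp only [fcalc, Complex.one_re, Complex.one_im]
    rw [cfc_const_one ℝ (resolventSq D) (isSelfAdjoint_resolventSq D), cfc_const_zero]
    simp
  rwa [h1] at h

/-- The function `F` of `√A` as a function of `(1 + A ^ 2)⁻¹`, extended from `(0, 1]` to the line,
with the value `c` on `(-∞, 0]`. -/
noncomputable def pullback (F : ℝ → ℂ) (c : ℂ) (t : ℝ) : ℂ := if t ≤ 0 then c else F (invParam t)

lemma tendsto_invParam : Tendsto invParam (𝓝[>] 0) atTop := by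
  have h : Tendsto (fun t : ℝ => t⁻¹ - 1) (𝓝[>] 0) atTop :=
    tendsto_atTop_add_const_right _ _ tendsto_inv_nhdsGT_zero
  exact Real.tendsto_sqrt_atTop.comp (Real.tendsto_sqrt_atTop.comp h)

/-- Only `t = 0` is delicate: `t → 0+` corresponds to `l → ∞`, so the constant filled in on the left
must be the limit of `F` at infinity. -/
lemma continuous_pullback {F : ℝ → ℂ} {c : ℂ} (hF : Continuous F) (hc : Tendsto F atTop (𝓝 c)) :
    Continuous (pullback F c) := by
  rw [continuous_iff_continuousAt]
  intro t
  rcases lt_trichotomy t 0 with ht | rfl | ht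
  · refine (continuousAt_const (y := c)).congr ?_
    filter_upwards [Iio_mem_nhds ht] with s hs
    simp [pullback, (Set.mem_Iio.1 hs).le]
  · rw [continuousAt_iff_continuous_left'_right']
    have h0 : pullback F c 0 = c := by simp [pullback]
    constructor
    · refine (continuousWithinAt_const (b := c)).congr (fun s hs => ?_) h0
      simp [pullback, (Set.mem_Iio.1 hs).le]
    · rw [ContinuousWithinAt, h0]
      refine (hc.comp tendsto_invParam).congr' ?_
      filter_upwards [self_mem_nhdsWithin] with s hs
      simp [pullback, not_le.2 (Set.mem_Ioi.1 hs)]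
  · have h1 : ContinuousAt (fun s => F (invParam s)) t := by
      refine hF.continuousAt.comp ?_
      unfold invParam
      exact ((continuousAt_inv₀ ht.ne').sub continuousAt_const).sqrt.sqrt
    refine h1.congr ?_
    filter_upwards [Ioi_mem_nhds ht] with s hs
    simp [pullback, not_le.2 (Set.mem_Ioi.1 hs)]

/-- By the conventions `0⁻¹ = 0` and `√x = 0` for `x ≤ 0`, spectral mass of `(1 + A²)⁻¹` at `t = 0`
is sent to `l = 0`. A multiplier therefore sees `F 0` there, whereas continuity of the pullback asks
for the limit of `F` at infinity; hence the hypothesis below that the two agree. -/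
lemma invParam_zero : invParam 0 = 0 := by
  have : √((0:ℝ)⁻¹ - 1) = 0 := Real.sqrt_eq_zero_of_nonpos (by norm_num)
  rw [invParam, this, Real.sqrt_zero]

lemma pullback_eq {F : ℝ → ℂ} {t : ℝ} (ht : 0 ≤ t) : pullback F (F 0) t = F (invParam t) := by
  rcases ht.eq_or_lt with rfl | ht
  · simp [pullback, invParam_zero]
  · simp [pullback, not_le.2 ht]

lemma isMultiplier_pullback {F : ℝ → ℂ} (hF : Continuous F) (hc : Tendsto F atTop (𝓝 (F 0))) :
    IsMultiplier D F (fcalc (resolventSq D) (pullback F (F 0))) := by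
  refine isMultiplier_of_ae (q := pullback F (F 0)) hF.measurable (fun u => ?_) fun u =>
    integral_specMeas_complex (spectrum_resolventSq_subset D) u (continuous_pullback hF hc)
  filter_upwards [ae_mem_Icc_specMeas (spectrum_resolventSq_subset D) u] with t ht
  exact (pullback_eq ht.1).symm

lemma norm_pullback_le {F : ℝ → ℂ} {C : ℝ} (hC : ∀ l, ‖F l‖ ≤ C) (t : ℝ) :
    ‖pullback F (F 0) t‖ ≤ C := by
  unfold pullback
  split_ifs
  · exact hC 0
  · exact hC _

/-- The factor 2 comes from estimating real and imaginary parts separately, and is harmless. -/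
lemma IsMultiplier.norm_le {F : ℝ → ℂ} {B : H →L[ℂ] H} (h : IsMultiplier D F B)
    (hF : Continuous F) (hc : Tendsto F atTop (𝓝 (F 0))) {C : ℝ} (hC : ∀ l, ‖F l‖ ≤ C) :
    ‖B‖ ≤ 2 * C := by
  rw [h.unique (isMultiplier_pullback hF hc)]
  exact norm_fcalc_le ((norm_nonneg _).trans (hC 0)) fun t _ => norm_pullback_le hC t

/-- The spectral projection of `(1 + A ^ 2)⁻¹` at `0`, by the mean ergodic theorem. -/
lemma exists_inner_eq_specMeas_zero {T : H →L[ℂ] H} (hT : IsSelfAdjoint T)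
    (hs : spectrum ℝ T ⊆ Set.Icc 0 1) :
    ∃ P : H →L[ℂ] H, ∀ u, inner ℂ u (P u) = ((specMeas T u).real {0} : ℂ) := by
  -- On `[0, 1]` the averages of `(1 - t)^k` are bounded by 1 and tend to the indicator of `{0}`,
  -- while the averages of `(1 - T)^k` tend strongly to the projection onto the fixed vectors of `1
  -- - T`.
  let f : H →L[ℂ] H := 1 - T
  have hf : f = cfc (fun t : ℝ => 1 - t) T := by
    rw [cfc_sub (fun _ : ℝ => (1:ℝ)) (fun t => t) T, cfc_const_one ℝ T hT, cfc_id' ℝ T hT]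
  have hf1 : ‖f‖ ≤ 1 := by
    rw [hf]
    refine norm_cfc_le zero_le_one fun t ht => ?_
    rw [Real.norm_eq_abs, abs_le]
    exact ⟨by linarith [(hs ht).2], by linarith [(hs ht).1]⟩
  let S := f.eqLocus (1 : H →L[ℂ] H)
  refine ⟨S.starProjection, fun u => ?_⟩
  have h1 : Tendsto (fun N => inner ℂ u (birkhoffAverage ℂ f _root_.id N u)) atTop
      (𝓝 (inner ℂ u (S.starProjection u))) :=
    tendsto_const_nhds.inner (f.tendsto_birkhoffAverage_orthogonalProjection hf1 u)
  have : IsFiniteMeasure (specMeas T u) := isFiniteMeasure_specMeas hs u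
  let a : ℕ → ℝ → ℂ := fun N t => (N : ℂ)⁻¹ * ∑ k ∈ Finset.range N, (((1 - t) ^ k : ℝ) : ℂ)
  have hak : ∀ k : ℕ, Integrable (fun t : ℝ => (((1 - t) ^ k : ℝ) : ℂ)) (specMeas T u) ∧
      ∫ t, (((1 - t) ^ k : ℝ) : ℂ) ∂(specMeas T u) = inner ℂ u ((f ^ k) u) := by
    intro k
    obtain ⟨i1, e1⟩ := integral_specMeas hs u (f := fun t => (1 - t) ^ k) (by fun_prop)
    refine ⟨i1.ofReal, ?_⟩
    rw [integral_complex_ofReal, e1, cfc_pow (fun t : ℝ => 1 - t) k T, ← hf]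
    have h3 := inner_cfc_real T (fun t => (1 - t) ^ k) u
    rw [cfc_pow (fun t : ℝ => 1 - t) k T, ← hf] at h3
    exact h3.symm
  have ha : ∀ N, inner ℂ u (birkhoffAverage ℂ f _root_.id N u) = ∫ t, a N t ∂(specMeas T u) := by
    intro N
    simp only [a, birkhoffAverage, birkhoffSum]
    rw [integral_const_mul, integral_finsetSum _ fun k _ => (hak k).1, inner_smul_right, inner_sum]
    congr 1
    refine Finset.sum_congr rfl fun k _ => ?_
    rw [(hak k).2, FunLike.coe_pow_eq_iterate]
    rfl
  have hlim : Tendsto (fun N => ∫ t, a N t ∂(specMeas T u)) atTop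
      (𝓝 (∫ t, Set.indicator {0} (fun _ => (1:ℂ)) t ∂(specMeas T u))) := by
    refine tendsto_integral_of_dominated_convergence (fun _ => 1) (fun N => ?_)
      (integrable_const 1) (fun N => ?_) ?_
    · exact ((integrable_finsetSum _ fun k _ => (hak k).1).const_mul _).aestronglyMeasurable
    · filter_upwards [ae_mem_Icc_specMeas hs u] with t ht
      have hb : ‖∑ k ∈ Finset.range N, (((1 - t) ^ k : ℝ) : ℂ)‖ ≤ N := by
        calc _ ≤ ∑ k ∈ Finset.range N, (1:ℝ) := by
              refine norm_sum_le_of_le _ fun k _ => ?_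
              rw [Complex.norm_real, norm_pow]
              refine pow_le_one₀ (norm_nonneg _) ?_
              rw [Real.norm_eq_abs, abs_le]
              exact ⟨by linarith [ht.2], by linarith [ht.1]⟩
          _ = N := by simp
      rw [norm_mul, norm_inv, Complex.norm_natCast]
      exact inv_mul_le_one_of_le₀ hb (Nat.cast_nonneg N)
    · filter_upwards [ae_mem_Icc_specMeas hs u] with t ht
      rcases ht.1.eq_or_lt with rfl | h0
      · simp only [Set.mem_singleton_iff, Set.indicator_of_mem]
        refine tendsto_const_nhds.congr' ?_
        filter_upwards [eventually_gt_atTop 0] with N hN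
        have : (N : ℂ) ≠ 0 := by exact_mod_cast hN.ne'
        simp [a, this]
      · rw [Set.indicator_of_notMem (by simpa using h0.ne')]
        have hr : ‖((1 - t : ℝ) : ℂ)‖ < 1 := by
          rw [Complex.norm_real, Real.norm_eq_abs, abs_lt]
          exact ⟨by linarith [ht.2], by linarith⟩
        have hg := (hasSum_geometric_of_norm_lt_one hr).tendsto_sum_nat
        have hz : Tendsto (fun N : ℕ => (N : ℂ)⁻¹) atTop (𝓝 0) := tendsto_inv_atTop_nhds_zero_nat
        have := hz.mul hg
        rw [zero_mul] at this
        refine this.congr fun N => ?_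
        simp [a]
  have h2 := tendsto_nhds_unique h1 ((tendsto_congr ha).2 hlim)
  rw [h2, integral_indicator (measurableSet_singleton 0)]
  simp [Measure.real]

/-- If the limit `c` differs from `F 0`, the continuous pullback has the wrong value at `t = 0`; the
spectral projection at that point corrects it. -/
lemma exists_isMultiplier {F : ℝ → ℂ} {c : ℂ} (hF : Continuous F) (hc : Tendsto F atTop (𝓝 c)) :
    ∃ B : H →L[ℂ] H, IsMultiplier D F B := by
  obtain ⟨P, hP⟩ := exists_inner_eq_specMeas_zero (isSelfAdjoint_resolventSq D)
    (spectrum_resolventSq_subset D)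
  have hs := spectrum_resolventSq_subset D
  refine ⟨fcalc (resolventSq D) (pullback F c) + (F 0 - c) • P,
    isMultiplier_of_ae (q := fun t => pullback F c t + Set.indicator {0} (fun _ => F 0 - c) t)
      hF.measurable (fun u => ?_) fun u => ?_⟩
  · filter_upwards [ae_mem_Icc_specMeas hs u] with t ht
    rcases ht.1.eq_or_lt with rfl | h0
    · simp [pullback, invParam_zero]
    · simp [pullback, not_le.2 h0, h0.ne']
  · have : IsFiniteMeasure (specMeas (resolventSq D) u) := isFiniteMeasure_specMeas hs u
    obtain ⟨i1, e1⟩ := integral_specMeas_complex hs u (continuous_pullback hF hc)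
    have i2 : Integrable (Set.indicator {0} (fun _ => F 0 - c)) (specMeas (resolventSq D) u) :=
      (integrable_const _).indicator (measurableSet_singleton 0)
    refine ⟨i1.add i2, ?_⟩
    rw [integral_add i1 i2, ← e1, add_apply, smul_apply, inner_add_right, inner_smul_right, hP,
      integral_indicator (measurableSet_singleton 0)]
    simp [mul_comm, Measure.real]

end Multiplier

/-! ### Multipliers under a unitary that scales the operator -/

section Dilation

variable {H : Type*} [NormedAddCommGroup H] [InnerProductSpace ℂ H] [CompleteSpace H]
  {D : Set (H × H)}

/-- The function of `(1 + A ^ 2)⁻¹` which gives `(1 + r ^ 4 A ^ 2)⁻¹`. -/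
noncomputable def dilParam (r t : ℝ) : ℝ := t * (t + r ^ 4 * (1 - t))⁻¹

lemma dilParam_denom_pos {r t : ℝ} (hr : 0 < r) (ht : t ∈ Set.Icc (0:ℝ) 1) :
    0 < t + r ^ 4 * (1 - t) := by
  rcases ht.1.eq_or_lt with rfl | h0
  · simp; positivity
  · have : 0 ≤ r ^ 4 * (1 - t) := mul_nonneg (by positivity) (by linarith [ht.2])
    linarith

/-- With `t = (1 + l⁴)⁻¹`, `dilParam r t` is `(1 + (rl)⁴)⁻¹`; at `t = 0` both sides are zero by
convention. -/
lemma invParam_dilParam {r t : ℝ} (hr : 0 < r) (ht : t ∈ Set.Icc (0:ℝ) 1) :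
    invParam (dilParam r t) = r * invParam t := by
  rcases ht.1.eq_or_lt with rfl | h0
  · simp [dilParam, invParam_zero]
  · have h1 : (dilParam r t)⁻¹ - 1 = (r ^ 2) ^ 2 * (t⁻¹ - 1) := by
      unfold dilParam
      have := (dilParam_denom_pos hr ht).ne'
      field_simp
      ring
    unfold invParam
    rw [h1, Real.sqrt_mul (by positivity), Real.sqrt_sq (by positivity),
      Real.sqrt_mul (by positivity), Real.sqrt_sq hr.le]

/-- A unitary operator which scales `A` by `r ^ 2` scales `√A` by `r`. -/
lemma conj_resolventSq {r : ℝ} (hr : 0 < r) (U : H ≃ₗᵢ[ℂ] H)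
    (h1 : ∀ x y : H, WithLp.toLp 2 (x, y) ∈ closedGraph D →
      WithLp.toLp 2 (U x, ((r ^ 2 : ℝ) : ℂ) • U y) ∈ closedGraph D)
    (h2 : ∀ x y : H, WithLp.toLp 2 (x, y) ∈ closedGraph D →
      WithLp.toLp 2 (U.symm x, (((r ^ 2)⁻¹ : ℝ) : ℂ) • U.symm y) ∈ closedGraph D) :
    U.symm.conjStarAlgEquiv (resolventSq D) = cfc (dilParam r) (resolventSq D) := by
  set T := resolventSq D
  have hT : IsSelfAdjoint T := isSelfAdjoint_resolventSq D
  have hs := spectrum_resolventSq_subset D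
  -- Formally `A U = r² U A`, so for `x = T u` one has `(1 + A²) U x = U (x + r⁴ A² x)`, and `A² x =
  -- u - x`. The weak characterization of `T` makes this rigorous.
  have key : U.symm.conjStarAlgEquiv T * (T + (r ^ 4 : ℝ) • (1 - T)) = T := by
    ext u
    obtain ⟨w, hw, ho⟩ := exists_resolventSq D u
    set z : H := T u + (r ^ 4 : ℝ) • (u - T u) with hz
    have hTz : T (U z) = U (T u) := by
      refine resolventSq_eq D (h1 _ _ hw) fun v hv => ?_
      have hv' := ho _ (h2 v.fst v.snd hv)
      have e1 : inner ℂ (U z - U (T u)) v.fst = ((r ^ 4 : ℝ) : ℂ) *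
          inner ℂ (u - T u) (U.symm v.fst) := by
        rw [← map_sub, LinearIsometryEquiv.inner_map_eq_flip, hz, add_sub_cancel_left,
          ← Complex.coe_smul, inner_smul_left, Complex.conj_ofReal]
      have e2 : inner ℂ (((r ^ 2 : ℝ) : ℂ) • U w) v.snd = ((r ^ 4 : ℝ) : ℂ) *
          inner ℂ w ((((r ^ 2)⁻¹ : ℝ) : ℂ) • U.symm v.snd) := by
        rw [inner_smul_left, LinearIsometryEquiv.inner_map_eq_flip, inner_smul_right,
          Complex.conj_ofReal, ← mul_assoc, ← Complex.ofReal_mul]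
        congr 2
        field_simp
      rw [e1, e2, ← mul_sub]
      exact mul_eq_zero_of_right _ hv'
    change U.symm (T (U.symm.symm (T u + (r ^ 4 : ℝ) • (u - T u)))) = T u
    rw [← hz, LinearIsometryEquiv.symm_symm, hTz, LinearIsometryEquiv.symm_apply_apply]
  have hd : T + (r ^ 4 : ℝ) • (1 - T) = cfc (fun t : ℝ => t + r ^ 4 * (1 - t)) T := by
    rw [cfc_add T (fun t : ℝ => t) (fun t => r ^ 4 * (1 - t)), cfc_const_mul _ (fun t => 1 - t) T,
      cfc_sub (fun _ : ℝ => (1:ℝ)) (fun t => t) T, cfc_const_one ℝ T hT, cfc_id' ℝ T hT]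
  have hcont : ContinuousOn (fun t : ℝ => (t + r ^ 4 * (1 - t))⁻¹) (spectrum ℝ T) :=
    ContinuousOn.inv₀ (by fun_prop) fun t ht => (dilParam_denom_pos hr (hs ht)).ne'
  have hinv : (T + (r ^ 4 : ℝ) • (1 - T)) * cfc (fun t : ℝ => (t + r ^ 4 * (1 - t))⁻¹) T = 1 := by
    rw [hd, ← cfc_mul _ _ T (by fun_prop) hcont, ← cfc_const_one ℝ T hT]
    exact cfc_congr fun t ht => mul_inv_cancel₀ (dilParam_denom_pos hr (hs ht)).ne'
  calc U.symm.conjStarAlgEquiv T = U.symm.conjStarAlgEquiv T * ((T + (r ^ 4 : ℝ) • (1 - T)) *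
        cfc (fun t : ℝ => (t + r ^ 4 * (1 - t))⁻¹) T) := by rw [hinv, mul_one]
    _ = T * cfc (fun t : ℝ => (t + r ^ 4 * (1 - t))⁻¹) T := by rw [← mul_assoc, key]
    _ = cfc (fun t : ℝ => t) T * cfc (fun t : ℝ => (t + r ^ 4 * (1 - t))⁻¹) T := by
        rw [cfc_id' ℝ T hT]
    _ = cfc (dilParam r) T := (cfc_mul _ _ T (by fun_prop) hcont).symm

lemma IsMultiplier.dilate {r : ℝ} (hr : 0 < r) (U : H ≃ₗᵢ[ℂ] H)
    (h1 : ∀ x y : H, WithLp.toLp 2 (x, y) ∈ closedGraph D →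
      WithLp.toLp 2 (U x, ((r ^ 2 : ℝ) : ℂ) • U y) ∈ closedGraph D)
    (h2 : ∀ x y : H, WithLp.toLp 2 (x, y) ∈ closedGraph D →
      WithLp.toLp 2 (U.symm x, (((r ^ 2)⁻¹ : ℝ) : ℂ) • U.symm y) ∈ closedGraph D)
    {F : ℝ → ℂ} {B : H →L[ℂ] H} (h : IsMultiplier D F B)
    (hF : Continuous F) (hc : Tendsto F atTop (𝓝 (F 0))) :
    IsMultiplier D (fun l => F (r * l)) (U.symm.conjStarAlgEquiv B) := by
  have hs := spectrum_resolventSq_subset D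
  have hcont : ContinuousOn (dilParam r) (spectrum ℝ (resolventSq D)) :=
    continuousOn_id.mul (ContinuousOn.inv₀ (by fun_prop) fun t ht =>
      (dilParam_denom_pos hr (hs ht)).ne')
  have hc' : Tendsto (fun l => F (r * l)) atTop (𝓝 (F (r * 0))) := by
    rw [mul_zero]
    exact hc.comp (tendsto_id.const_mul_atTop hr)
  have hq := continuous_pullback hF hc
  rw [h.unique (isMultiplier_pullback hF hc), conj_fcalc (isSelfAdjoint_resolventSq D) _ hq,
    conj_resolventSq hr U h1 h2, fcalc_comp (isSelfAdjoint_resolventSq D) hq hcont]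
  have := isMultiplier_pullback (D := D) (F := fun l => F (r * l)) (by fun_prop) hc'
  rwa [fcalc_congr (g' := pullback F (F 0) ∘ dilParam r) fun t ht => ?_] at this
  have ht' := hs ht
  have h0 : 0 ≤ dilParam r t := mul_nonneg ht'.1 (inv_nonneg.2 (dilParam_denom_pos hr ht').le)
  simp only [Function.comp_apply]
  rw [pullback_eq h0, invParam_dilParam hr ht']
  exact pullback_eq (F := fun l => F (r * l)) ht'.1

end Dilation

end OscMult

namespace OscMult

/-! ### Marcinkiewicz interpolation between `L¹` and `L²` with explicit constants -/

section Interpolation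

variable {X : Type*} [MeasurableSpace X] {μ : Measure X}

lemma lintegral_Ioo_rpow {p y : ℝ} (hp : 1 < p) (hy : 0 ≤ y) :
    ∫⁻ a in Set.Ioo 0 y, ENNReal.ofReal (a ^ (p - 2)) = ENNReal.ofReal (y ^ (p - 1) / (p - 1)) := by
  have hi : IntegrableOn (fun a : ℝ => a ^ (p - 2)) (Set.Ioo 0 y) :=
    ((intervalIntegrable_iff_integrableOn_Ioo_of_le hy).1
      (intervalIntegral.intervalIntegrable_rpow' (by linarith)))
  rw [← ofReal_integral_eq_lintegral_ofReal hi]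
  · rw [← integral_Ioc_eq_integral_Ioo, ← intervalIntegral.integral_of_le hy,
      integral_rpow (Or.inl (by linarith)), Real.zero_rpow (by linarith)]
    congr 1
    rw [show p - 2 + 1 = p - 1 by ring]
    ring
  · exact (ae_restrict_iff' measurableSet_Ioo).2 (ae_of_all _ fun a ha => Real.rpow_nonneg ha.1.le _)

lemma lintegral_Ioi_rpow {p y : ℝ} (hp : p < 2) (hy : 0 < y) :
    ∫⁻ a in Set.Ioi y, ENNReal.ofReal (a ^ (p - 3)) = ENNReal.ofReal (y ^ (p - 2) / (2 - p)) := by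
  rw [← ofReal_integral_eq_lintegral_ofReal (integrableOn_Ioi_rpow_of_lt (by linarith) hy)]
  · rw [integral_Ioi_rpow_of_lt (by linarith) hy]
    congr 1
    rw [show p - 3 + 1 = p - 2 by ring, neg_div, ← div_neg, neg_sub]
  · exact (ae_restrict_iff' measurableSet_Ioi).2
      (ae_of_all _ fun a ha => Real.rpow_nonneg (hy.trans ha).le _)

/-- The constant in the real interpolation inequality between `L¹` and `L²`. -/
noncomputable def interpConst (p : ℝ) : ℝ := p * (2 / (p - 1) + 4 / (2 - p))

lemma interpConst_pos {p : ℝ} (hp1 : 1 < p) (hp2 : p < 2) : 0 < interpConst p := by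
  have : 0 < p - 1 := by linarith
  have : 0 < 2 - p := by linarith
  have : 0 < p := by linarith
  unfold interpConst
  positivity

/-- The integration in Marcinkiewicz interpolation between `L¹` and `L²`. -/
lemma lintegral_rpow_le_of_distribution_le [SigmaFinite μ] {F h : X → ℝ} (hF : Measurable F)
    (hh : Measurable h) (hF0 : ∀ x, 0 ≤ F x) (hh0 : ∀ x, 0 ≤ h x) {p c M₁ M₂ : ℝ}
    (hp1 : 1 < p) (hp2 : p < 2) (hc : 0 < c) (hM₁ : 0 ≤ M₁)
    (H : ∀ a, 0 < a → μ {x | a < h x} ≤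
      ENNReal.ofReal (2 * M₁ / a) * ∫⁻ x in {x | c * a < F x}, ENNReal.ofReal (F x) ∂μ +
      ENNReal.ofReal ((2 * M₂ / a) ^ 2) *
        ∫⁻ x in {x | c * a < F x}ᶜ, ENNReal.ofReal (F x ^ 2) ∂μ) :
    ∫⁻ x, ENNReal.ofReal (h x ^ p) ∂μ ≤
      ENNReal.ofReal (p * (2 * M₁ * c ^ (1 - p) / (p - 1) + 4 * M₂ ^ 2 * c ^ (2 - p) / (2 - p))) *
        ∫⁻ x, ENNReal.ofReal (F x ^ p) ∂μ := by
  have hp0 : 0 < p := by linarith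
  have hp1' : 0 < p - 1 := by linarith
  have hp2' : 0 < 2 - p := by linarith
  -- These are the integrands of the two terms of the hypothesis, multiplied by the layer-cake
  -- weight `a^(p-1)`. After Fubini, the integral of `k₁` over `0 < a < F x / c` converges because
  -- `p > 1`, and that of `k₂` over `a ≥ F x / c` because `p < 2`.
  let k₁ : ℝ → X → ℝ≥0∞ := fun a x =>
    if c * a < F x then ENNReal.ofReal (2 * M₁ * a ^ (p - 2) * F x) else 0
  let k₂ : ℝ → X → ℝ≥0∞ := fun a x =>
    if c * a < F x then 0 else ENNReal.ofReal (4 * M₂ ^ 2 * a ^ (p - 3) * F x ^ 2)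
  have hS : MeasurableSet {z : ℝ × X | c * z.1 < F z.2} :=
    measurableSet_lt (by fun_prop) (by fun_prop)
  have mk₁ : Measurable (Function.uncurry k₁) := by
    refine Measurable.ite hS ?_ measurable_const
    fun_prop
  have mk₂ : Measurable (Function.uncurry k₂) := by
    refine Measurable.ite hS measurable_const ?_
    fun_prop
  have mi : Measurable fun a => ∫⁻ x, k₁ a x ∂μ := mk₁.lintegral_prod_right'
  have hSa : ∀ a, MeasurableSet {x | c * a < F x} := fun a =>
    measurableSet_lt measurable_const hF
  have step : ∀ a ∈ Set.Ioi (0:ℝ), μ {x | a < h x} * ENNReal.ofReal (a ^ (p - 1)) ≤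
      ∫⁻ x, k₁ a x ∂μ + ∫⁻ x, k₂ a x ∂μ := by
    intro a (ha : 0 < a)
    refine (mul_le_mul_left (H a ha) _).trans (le_of_eq ?_)
    have e1 : ENNReal.ofReal (a ^ (p - 1)) * ENNReal.ofReal (2 * M₁ / a) =
        ENNReal.ofReal (2 * M₁ * a ^ (p - 2)) := by
      rw [← ENNReal.ofReal_mul (by positivity)]
      congr 1
      rw [show p - 1 = (p - 2) + 1 by ring, Real.rpow_add_one ha.ne']
      field_simp
    have e2 : ENNReal.ofReal (a ^ (p - 1)) * ENNReal.ofReal ((2 * M₂ / a) ^ 2) =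
        ENNReal.ofReal (4 * M₂ ^ 2 * a ^ (p - 3)) := by
      rw [← ENNReal.ofReal_mul (by positivity)]
      congr 1
      rw [show p - 1 = (p - 3) + 1 + 1 by ring, Real.rpow_add_one ha.ne', Real.rpow_add_one ha.ne']
      field_simp
      ring
    rw [mul_comm, mul_add, ← mul_assoc, ← mul_assoc, e1, e2]
    congr 1
    · rw [← lintegral_const_mul _ (by fun_prop), ← lintegral_indicator (hSa a)]
      refine lintegral_congr fun x => ?_
      by_cases hx : c * a < F x
      · simp only [k₁, hx, if_true, Set.indicator, Set.mem_ofPred_eq]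
        rw [← ENNReal.ofReal_mul (by positivity)]
      · simp [k₁, hx, Set.indicator]
    · rw [← lintegral_const_mul _ (by fun_prop), ← lintegral_indicator (hSa a).compl]
      refine lintegral_congr fun x => ?_
      by_cases hx : c * a < F x
      · simp [k₂, hx, Set.indicator]
      · simp only [k₂, hx, if_false, Set.indicator, Set.mem_compl_iff, Set.mem_ofPred_eq,
          not_false_eq_true, if_true]
        rw [← ENNReal.ofReal_mul (by positivity)]
  have I₁ : ∀ x, ∫⁻ a in Set.Ioi 0, k₁ a x =
      ENNReal.ofReal (2 * M₁ * c ^ (1 - p) / (p - 1)) * ENNReal.ofReal (F x ^ p) := by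
    intro x
    have e : ∫⁻ a in Set.Ioi 0, k₁ a x = ∫⁻ a in Set.Ioo 0 (F x / c),
        ENNReal.ofReal (2 * M₁ * F x) * ENNReal.ofReal (a ^ (p - 2)) := by
      rw [← lintegral_indicator measurableSet_Ioi, ← lintegral_indicator measurableSet_Ioo]
      refine lintegral_congr fun a => ?_
      by_cases h0 : 0 < a
      · by_cases h1 : c * a < F x
        · have h1' : a < F x / c := by rw [lt_div_iff₀ hc]; linarith
          simp only [Set.indicator, Set.mem_Ioi, Set.mem_Ioo, h0, h1, h1', k₁, if_true, and_self]
          rw [← ENNReal.ofReal_mul (mul_nonneg (by positivity) (hF0 x))]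
          congr 1; ring
        · have h1' : ¬ a < F x / c := by rw [lt_div_iff₀ hc]; linarith
          simp [Set.indicator, h0, h1, h1', k₁]
      · simp [Set.indicator, h0]
    rw [e, lintegral_const_mul _ (by fun_prop), lintegral_Ioo_rpow hp1 (div_nonneg (hF0 x) hc.le),
      ← ENNReal.ofReal_mul (mul_nonneg (by positivity) (hF0 x)),
      ← ENNReal.ofReal_mul (by positivity)]
    congr 1
    have hFp : F x ^ p = F x * F x ^ (p - 1) := by
      rcases (hF0 x).eq_or_lt with h0 | h0
      · rw [← h0, Real.zero_rpow hp0.ne', zero_mul]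
      · rw [mul_comm, ← Real.rpow_add_one h0.ne']; congr 1; ring
    rw [hFp, Real.div_rpow (hF0 x) hc.le, show 1 - p = -(p - 1) by ring, Real.rpow_neg hc.le]
    field_simp
  have I₂ : ∀ x, ∫⁻ a in Set.Ioi 0, k₂ a x =
      ENNReal.ofReal (4 * M₂ ^ 2 * c ^ (2 - p) / (2 - p)) * ENNReal.ofReal (F x ^ p) := by
    intro x
    -- If `F x = 0`, the tail integral would start at `a = 0`, where `a^(p-3)` is not integrable;
    -- but then `k₂` vanishes.
    rcases (hF0 x).eq_or_lt with hx0 | hx0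
    · have : ∀ a, k₂ a x = 0 := fun a => by simp [k₂, ← hx0]
      simp [this, ← hx0, Real.zero_rpow hp0.ne']
    have e : ∫⁻ a in Set.Ioi 0, k₂ a x = ∫⁻ a in Set.Ici (F x / c),
        ENNReal.ofReal (4 * M₂ ^ 2 * F x ^ 2) * ENNReal.ofReal (a ^ (p - 3)) := by
      rw [← lintegral_indicator measurableSet_Ioi, ← lintegral_indicator measurableSet_Ici]
      refine lintegral_congr fun a => ?_
      by_cases h1 : c * a < F x
      · have h1' : ¬ F x / c ≤ a := by rw [div_le_iff₀ hc]; linarith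
        simp [Set.indicator, h1, h1', k₂]
      · have h1' : F x / c ≤ a := by rw [div_le_iff₀ hc]; linarith
        have h0 : 0 < a := (div_pos hx0 hc).trans_le h1'
        simp only [Set.indicator, Set.mem_Ioi, Set.mem_Ici, h0, h1, h1', k₂, if_true, if_false]
        rw [← ENNReal.ofReal_mul (by positivity)]
        congr 1; ring
    rw [e, lintegral_const_mul _ (by fun_prop), setLIntegral_congr Ioi_ae_eq_Ici.symm,
      lintegral_Ioi_rpow hp2 (div_pos hx0 hc), ← ENNReal.ofReal_mul (by positivity),
      ← ENNReal.ofReal_mul (by positivity)]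
    congr 1
    have hFp : F x ^ p = F x ^ 2 * F x ^ (p - 2) := by
      rw [← Real.rpow_natCast, ← Real.rpow_add hx0]; congr 1; push_cast; ring
    rw [hFp, Real.div_rpow (hF0 x) hc.le, show 2 - p = -(p - 2) by ring, Real.rpow_neg hc.le]
    field_simp
  have lc := lintegral_rpow_eq_lintegral_meas_lt_mul μ (ae_of_all _ hh0) hh.aemeasurable hp0
  rw [lc]
  calc ENNReal.ofReal p * ∫⁻ a in Set.Ioi 0, μ {x | a < h x} * ENNReal.ofReal (a ^ (p - 1))
      ≤ ENNReal.ofReal p * ∫⁻ a in Set.Ioi 0, (∫⁻ x, k₁ a x ∂μ + ∫⁻ x, k₂ a x ∂μ) := by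
        gcongr 1
        exact setLIntegral_mono' measurableSet_Ioi step
    _ = ENNReal.ofReal p * (∫⁻ x, (∫⁻ a in Set.Ioi 0, k₁ a x) ∂μ +
          ∫⁻ x, (∫⁻ a in Set.Ioi 0, k₂ a x) ∂μ) := by
        rw [lintegral_add_left mi, lintegral_lintegral_swap mk₁.aemeasurable,
          lintegral_lintegral_swap mk₂.aemeasurable]
    _ = _ := by
        simp_rw [I₁, I₂]
        rw [lintegral_const_mul _ (by fun_prop), lintegral_const_mul _ (by fun_prop), ← add_mul,
          ← mul_assoc, ENNReal.ofReal_mul hp0.le, ENNReal.ofReal_add (by positivity) (by positivity)]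

lemma eLpNorm_ofReal_eq {p : ℝ} (hp : 0 < p) (f : X → ℂ) :
    eLpNorm f (ENNReal.ofReal p) μ = (∫⁻ x, ENNReal.ofReal (‖f x‖ ^ p) ∂μ) ^ (1 / p) := by
  rw [eLpNorm_eq_lintegral_rpow_enorm_toReal (by simpa using hp) ENNReal.ofReal_ne_top,
    ENNReal.toReal_ofReal hp.le]
  congr 1
  refine lintegral_congr fun x => ?_
  rw [← ofReal_norm, ENNReal.ofReal_rpow_of_nonneg (norm_nonneg _) hp.le]

lemma eLpNorm_two_sq (f : X → ℂ) (ν : Measure X) :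
    eLpNorm f 2 ν ^ 2 = ∫⁻ x, ENNReal.ofReal (‖f x‖ ^ 2) ∂ν := by
  have := eLpNorm_ofReal_eq (μ := ν) (p := 2) two_pos f
  rw [show ENNReal.ofReal 2 = 2 by simp] at this
  rw [this, ← ENNReal.rpow_natCast, ← ENNReal.rpow_mul]
  norm_num

/-- The distribution function of an operator bounded on `L¹` and on `L²`. -/
lemma meas_lt_norm_le (B : Lp ℂ 2 μ →L[ℂ] Lp ℂ 2 μ) {M₁ M₂ : ℝ} (hM₂ : 0 ≤ M₂)
    (h₁ : ∀ u, eLpNorm (B u) 1 μ ≤ ENNReal.ofReal M₁ * eLpNorm u 1 μ) (h₂ : ‖B‖ ≤ M₂)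
    (u : Lp ℂ 2 μ) {S : Set X} (hS : MeasurableSet S) {a : ℝ} (ha : 0 < a) :
    μ {x | a < ‖B u x‖} ≤
      ENNReal.ofReal (2 * M₁ / a) * ∫⁻ x in S, ENNReal.ofReal ‖u x‖ ∂μ +
      ENNReal.ofReal ((2 * M₂ / a) ^ 2) * ∫⁻ x in Sᶜ, ENNReal.ofReal (‖u x‖ ^ 2) ∂μ := by
  obtain ⟨u₁, e₁⟩ : ∃ u₁ : Lp ℂ 2 μ, u₁ =ᵐ[μ] S.indicator u :=
    ⟨((Lp.memLp u).indicator hS).toLp _, MemLp.coeFn_toLp _⟩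
  obtain ⟨u₂, e₂⟩ : ∃ u₂ : Lp ℂ 2 μ, u₂ =ᵐ[μ] Sᶜ.indicator u :=
    ⟨((Lp.memLp u).indicator hS.compl).toLp _, MemLp.coeFn_toLp _⟩
  have hu : u = u₁ + u₂ := by
    ext1
    filter_upwards [e₁, e₂, Lp.coeFn_add u₁ u₂] with x h1 h2 h3
    rw [h3, Pi.add_apply, h1, h2]
    exact (congrFun (Set.indicator_self_add_compl S u) x).symm
  have hBu : B u =ᵐ[μ] fun x => B u₁ x + B u₂ x := by
    conv_lhs => rw [hu, map_add]
    exact Lp.coeFn_add _ _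
  have hsub : μ {x | a < ‖B u x‖} ≤ μ {x | ENNReal.ofReal (a / 2) ≤ ‖B u₁ x‖ₑ} +
      μ {x | ENNReal.ofReal (a / 2) ≤ ‖B u₂ x‖ₑ} := by
    refine (measure_mono_ae ?_).trans (measure_union_le _ _)
    filter_upwards [hBu] with x hx (hax : a < ‖B u x‖)
    have h4 : a < ‖B u₁ x‖ + ‖B u₂ x‖ := by
      rw [hx] at hax
      exact hax.trans_le (norm_add_le _ _)
    rcases le_or_gt (a / 2) ‖B u₁ x‖ with h5 | h5
    · left
      change ENNReal.ofReal (a / 2) ≤ ‖B u₁ x‖ₑ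
      rw [← ofReal_norm]
      exact ENNReal.ofReal_le_ofReal h5
    · right
      change ENNReal.ofReal (a / 2) ≤ ‖B u₂ x‖ₑ
      rw [← ofReal_norm]
      exact ENNReal.ofReal_le_ofReal (by linarith)
  have ha2 : ENNReal.ofReal (a / 2) ≠ 0 := by simpa using ha
  have hinv : (ENNReal.ofReal (a / 2))⁻¹ = ENNReal.ofReal (2 / a) := by
    rw [← ENNReal.ofReal_inv_of_pos (by positivity), inv_div]
  refine hsub.trans (add_le_add ?_ ?_)
  · have h6 := meas_ge_le_mul_pow_eLpNorm_enorm μ one_ne_zero ENNReal.one_ne_top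
      (Lp.aestronglyMeasurable (B u₁)) ha2 (fun h => absurd h ENNReal.ofReal_ne_top)
    rw [ENNReal.toReal_one, ENNReal.rpow_one, ENNReal.rpow_one, hinv] at h6
    refine h6.trans ((mul_le_mul_right (h₁ u₁) _).trans (le_of_eq ?_))
    rw [eLpNorm_congr_ae e₁, eLpNorm_indicator_eq_eLpNorm_restrict hS,
      eLpNorm_one_eq_lintegral_enorm, ← mul_assoc, ← ENNReal.ofReal_mul (by positivity)]
    simp only [← ofReal_norm]
    congr 2
    field_simp
  · have h6 := meas_ge_le_mul_pow_eLpNorm_enorm μ two_ne_zero ENNReal.ofNat_ne_top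
      (Lp.aestronglyMeasurable (B u₂)) ha2 (fun h => absurd h ENNReal.ofReal_ne_top)
    rw [hinv, ENNReal.toReal_ofNat, ENNReal.rpow_ofNat, ENNReal.rpow_ofNat] at h6
    have h7 : eLpNorm (B u₂) 2 μ ≤ ENNReal.ofReal M₂ * eLpNorm u₂ 2 μ := by
      rw [← Lp.enorm_def, ← Lp.enorm_def, ← ofReal_norm, ← ofReal_norm, ← ENNReal.ofReal_mul hM₂]
      exact ENNReal.ofReal_le_ofReal (B.le_of_opNorm_le h₂ u₂)
    refine h6.trans ((mul_le_mul_right (pow_le_pow_left' h7 2) _).trans (le_of_eq ?_))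
    rw [eLpNorm_congr_ae e₂, eLpNorm_indicator_eq_eLpNorm_restrict hS.compl, mul_pow,
      eLpNorm_two_sq, ← mul_assoc, ← mul_pow, ← ENNReal.ofReal_mul (by positivity),
      ← ENNReal.ofReal_pow (by positivity)]
    congr 3
    field_simp

/-- Marcinkiewicz interpolation between `L¹` and `L²`. -/
lemma eLpNorm_interpolate [SigmaFinite μ] (B : Lp ℂ 2 μ →L[ℂ] Lp ℂ 2 μ) {p M₁ M₂ : ℝ}
    (hp1 : 1 < p) (hp2 : p < 2) (hM₁ : 0 < M₁) (hM₂ : 0 < M₂)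
    (h₁ : ∀ u, eLpNorm (B u) 1 μ ≤ ENNReal.ofReal M₁ * eLpNorm u 1 μ) (h₂ : ‖B‖ ≤ M₂)
    (u : Lp ℂ 2 μ) :
    eLpNorm (B u) (ENNReal.ofReal p) μ ≤
      ENNReal.ofReal (interpConst p ^ (1 / p) * (M₁ ^ (2 / p - 1) * M₂ ^ (2 - 2 / p))) *
        eLpNorm u (ENNReal.ofReal p) μ := by
  have hp0 : 0 < p := by linarith
  -- This cutting level balances the two terms: both become multiples of `M₁^(2-p) M₂^(2p-2)`, whose
  -- `p`-th root is the convexity bound.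
  set c := M₁ / M₂ ^ 2 with hcdef
  have hc : 0 < c := by positivity
  have mu : Measurable fun x => ‖u x‖ := (Lp.stronglyMeasurable u).norm.measurable
  have mB : Measurable fun x => ‖B u x‖ := (Lp.stronglyMeasurable (B u)).norm.measurable
  have key := lintegral_rpow_le_of_distribution_le mu mB (fun _ => norm_nonneg _)
    (fun _ => norm_nonneg _) hp1 hp2 hc hM₁.le
    fun a ha => meas_lt_norm_le B hM₂.le h₁ h₂ u (measurableSet_lt measurable_const mu) ha
  have hconst : p * (2 * M₁ * c ^ (1 - p) / (p - 1) + 4 * M₂ ^ 2 * c ^ (2 - p) / (2 - p)) =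
      interpConst p * (M₁ ^ (2 - p) * M₂ ^ (2 * p - 2)) := by
    have e1 : c ^ (1 - p) * M₁ = M₁ ^ (2 - p) * M₂ ^ (2 * p - 2) := by
      rw [hcdef, Real.div_rpow hM₁.le (by positivity), ← Real.rpow_natCast M₂ 2,
        ← Real.rpow_mul hM₂.le, show 2 - p = (1 - p) + 1 by ring, Real.rpow_add_one hM₁.ne',
        show 2 * p - 2 = -((2:ℕ) * (1 - p)) by push_cast; ring, Real.rpow_neg hM₂.le]
      field_simp
    have e2 : c ^ (2 - p) * M₂ ^ 2 = c ^ (1 - p) * M₁ := by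
      rw [show 2 - p = (1 - p) + 1 by ring, Real.rpow_add_one hc.ne', mul_assoc]
      congr 1
      rw [hcdef]
      field_simp
    rw [← e1]
    unfold interpConst
    calc _ = p * (2 * (c ^ (1 - p) * M₁) / (p - 1) + 4 * (c ^ (2 - p) * M₂ ^ 2) / (2 - p)) := by
          ring
      _ = _ := by rw [e2]; ring
  rw [hconst] at key
  have hI := interpConst_pos hp1 hp2
  rw [eLpNorm_ofReal_eq hp0, eLpNorm_ofReal_eq hp0]
  refine (ENNReal.rpow_le_rpow key (by positivity)).trans (le_of_eq ?_)
  rw [ENNReal.mul_rpow_of_nonneg _ _ (by positivity),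
    ENNReal.ofReal_rpow_of_nonneg (by positivity) (by positivity)]
  congr 2
  rw [Real.mul_rpow hI.le (by positivity), Real.mul_rpow (by positivity) (by positivity),
    ← Real.rpow_mul hM₁.le, ← Real.rpow_mul hM₂.le]
  congr 3 <;> field_simp

end Interpolation

end OscMult

namespace OscMult

/-! ### Passage to the limit and duality in `Lᵖ` for operators on `L²` -/

section Limits

variable {X : Type*} [MeasurableSpace X] {μ : Measure X}

/-- Convergence in `L²` gives almost everywhere convergence along a subsequence, and Fatou's lemma
does the rest. -/
lemma eLpNorm_le_of_tendsto {p C : ℝ≥0∞} {v : ℕ → Lp ℂ 2 μ} {w : Lp ℂ 2 μ}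
    (h : Tendsto v atTop (𝓝 w)) (hC : ∀ N, eLpNorm (v N) p μ ≤ C) : eLpNorm w p μ ≤ C := by
  have hm : TendstoInMeasure μ (fun N => (v N : X → ℂ)) atTop w :=
    tendstoInMeasure_of_tendsto_Lp h
  obtain ⟨ns, -, hns⟩ := hm.exists_seq_tendsto_ae
  refine (Lp.eLpNorm_lim_le_liminf_eLpNorm (fun N => Lp.aestronglyMeasurable (v (ns N))) w
    hns).trans ?_
  exact liminf_le_of_le (by isBoundedDefault) fun b hb =>
    let ⟨N, hN⟩ := hb.exists
    hN.trans (hC _)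

/-- If the adjoint is bounded on `Lᵖ`, then the operator is bounded on the dual space. -/
lemma eLpNorm_le_of_adjoint (B : Lp ℂ 2 μ →L[ℂ] Lp ℂ 2 μ) {p q : ℝ} (hpq : p.HolderConjugate q)
    {C : ℝ≥0∞} (hB : ∀ v, eLpNorm (B.adjoint v) (ENNReal.ofReal p) μ ≤
      C * eLpNorm v (ENNReal.ofReal p) μ) (u : Lp ℂ 2 μ) :
    eLpNorm (B u) (ENNReal.ofReal q) μ ≤ C * eLpNorm u (ENNReal.ofReal q) μ := by
  have hp0 := hpq.pos
  have hq0 := hpq.symm.pos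
  set h : X → ℂ := (B u : X → ℂ) with hh
  have mh : StronglyMeasurable h := Lp.stronglyMeasurable _
  -- The truncation has finite measure by Chebyshev's inequality. It makes the test function `g`
  -- square integrable and `I` finite, so that `I^(1/p)` can be cancelled.
  let S : ℕ → Set X := fun N => {x | ((N : ℝ) + 1)⁻¹ ≤ ‖h x‖} ∩ {x | ‖h x‖ ≤ N + 1}
  have hS : ∀ N, MeasurableSet (S N) := fun N =>
    (measurableSet_le measurable_const mh.norm.measurable).inter
      (measurableSet_le mh.norm.measurable measurable_const)
  have hfin : ∀ N, μ (S N) < ⊤ := by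
    intro N
    have h1 := (Lp.memLp (B u)).meas_ge_lt_top two_ne_zero ENNReal.ofNat_ne_top
      (ε := ⟨((N : ℝ) + 1)⁻¹, by positivity⟩) fun h0 =>
        (by positivity : ((N : ℝ) + 1)⁻¹ ≠ 0) (congrArg NNReal.toReal h0)
    refine (measure_mono ?_).trans_lt h1
    intro x hx
    exact hx.1
  have hI : ∀ N, (∫⁻ x in S N, ENNReal.ofReal (‖h x‖ ^ q) ∂μ) ^ (1 / q) ≤
      C * eLpNorm u (ENNReal.ofReal q) μ := by
    intro N
    set I := ∫⁻ x in S N, ENNReal.ofReal (‖h x‖ ^ q) ∂μ with hIdef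
    -- The extremal function in Hölder's inequality: `‖g‖^p` and `‖g h‖` both equal `‖h‖^q` on `S
    -- N`.
    let g : X → ℂ := (S N).indicator fun x => ((‖h x‖ ^ (q - 2) : ℝ) : ℂ) * h x
    have hpos : ∀ x ∈ S N, 0 < ‖h x‖ := fun x hx =>
      (by positivity : 0 < ((N : ℝ) + 1)⁻¹).trans_le hx.1
    have hIfin : I ≠ ⊤ := by
      refine ne_top_of_le_ne_top (b := ENNReal.ofReal (((N : ℝ) + 1) ^ q) * μ (S N))
        (ENNReal.mul_ne_top ENNReal.ofReal_ne_top (hfin N).ne) ?_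
      rw [← setLIntegral_const]
      refine setLIntegral_mono' (hS N) fun x hx => ENNReal.ofReal_le_ofReal ?_
      exact Real.rpow_le_rpow (norm_nonneg _) hx.2 hq0.le
    have gnorm : ∀ x, ‖g x‖ = (S N).indicator (fun x => ‖h x‖ ^ (q - 1)) x := by
      intro x
      by_cases hx : x ∈ S N
      · simp only [g, Set.indicator_of_mem hx, norm_mul, Complex.norm_real, Real.norm_eq_abs]
        rw [abs_of_nonneg (Real.rpow_nonneg (norm_nonneg _) _), ← Real.rpow_add_one (hpos x hx).ne']
        congr 1; ring
      · simp [g, Set.indicator_of_notMem hx]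
    have mg : StronglyMeasurable g :=
      ((Complex.measurable_ofReal.comp (mh.norm.measurable.pow_const _)).stronglyMeasurable.mul
        mh).indicator (hS N)
    have hg2 : MemLp g 2 μ := by
      have : MemLp ((S N).indicator fun _ => ((N : ℝ) + 1) ^ (q - 1)) 2 μ :=
        memLp_indicator_const 2 (hS N) _ (Or.inr (hfin N).ne)
      refine this.mono mg.aestronglyMeasurable (ae_of_all _ fun x => ?_)
      rw [gnorm]
      by_cases hx : x ∈ S N
      · rw [Set.indicator_of_mem hx, Set.indicator_of_mem hx]
        refine (Real.rpow_le_rpow (norm_nonneg _) hx.2 hpq.symm.sub_one_pos.le).trans (le_abs_self _)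
      · simp [Set.indicator_of_notMem hx]
    let v : Lp ℂ 2 μ := hg2.toLp g
    have ev : v =ᵐ[μ] g := hg2.coeFn_toLp
    have e1 : I = ‖inner ℂ v (B u)‖ₑ := by
      have : inner ℂ v (B u) = ((∫ x in S N, ‖h x‖ ^ q ∂μ : ℝ) : ℂ) := by
        rw [L2.inner_def, ← integral_complex_ofReal, ← integral_indicator (hS N)]
        refine integral_congr_ae ?_
        filter_upwards [ev] with x hx
        simp only [hx]
        by_cases hxS : x ∈ S N
        · simp only [g, Set.indicator_of_mem hxS]
          change B u x * starRingEnd ℂ (((‖h x‖ ^ (q - 2) : ℝ) : ℂ) * h x) = _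
          rw [map_mul, Complex.conj_ofReal, mul_left_comm, ← hh, Complex.mul_conj,
            Complex.normSq_eq_norm_sq, ← Complex.ofReal_mul]
          congr 1
          rw [← Real.rpow_natCast, ← Real.rpow_add (hpos x hxS)]
          congr 1; push_cast; ring
        · simp [g, Set.indicator_of_notMem hxS]
      rw [this, ← ofReal_norm, Complex.norm_real, Real.norm_eq_abs,
        abs_of_nonneg (integral_nonneg fun x => Real.rpow_nonneg (norm_nonneg _) _), hIdef,
        integral_eq_lintegral_of_nonneg_ae (ae_of_all _ fun x =>
          Real.rpow_nonneg (norm_nonneg _) _)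
          (mh.norm.measurable.pow_const q).aestronglyMeasurable, ENNReal.ofReal_toReal hIfin]
    have e2 : ‖inner ℂ v (B u)‖ₑ ≤ eLpNorm (B.adjoint v) (ENNReal.ofReal p) μ *
        eLpNorm u (ENNReal.ofReal q) μ := by
      rw [← ContinuousLinearMap.adjoint_inner_left, L2.inner_def]
      refine (enorm_integral_le_lintegral_enorm _).trans ?_
      have := ENNReal.lintegral_mul_le_Lp_mul_Lq μ hpq
        (Lp.aestronglyMeasurable (B.adjoint v)).enorm (Lp.aestronglyMeasurable u).enorm
      rw [eLpNorm_eq_lintegral_rpow_enorm_toReal (by simpa using hp0) ENNReal.ofReal_ne_top,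
        eLpNorm_eq_lintegral_rpow_enorm_toReal (by simpa using hq0) ENNReal.ofReal_ne_top,
        ENNReal.toReal_ofReal hp0.le, ENNReal.toReal_ofReal hq0.le]
      refine le_trans (le_of_eq (lintegral_congr fun x => ?_)) this
      simp only [Pi.mul_apply]
      rw [← ofReal_norm, ← ofReal_norm, ← ofReal_norm, ← ENNReal.ofReal_mul (norm_nonneg _)]
      congr 1
      change ‖u x * starRingEnd ℂ (B.adjoint v x)‖ = _
      rw [norm_mul, RCLike.norm_conj, mul_comm]
    have e3 : eLpNorm v (ENNReal.ofReal p) μ = I ^ (1 / p) := by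
      rw [eLpNorm_congr_ae ev, eLpNorm_ofReal_eq hp0, hIdef, ← lintegral_indicator (hS N)]
      congr 1
      refine lintegral_congr fun x => ?_
      rw [gnorm]
      by_cases hx : x ∈ S N
      · simp only [Set.indicator_of_mem hx]
        rw [← Real.rpow_mul (norm_nonneg _), hpq.symm.sub_one_mul_conj]
      · simp [Set.indicator_of_notMem hx, Real.zero_rpow hp0.ne']
    have e4 : I ≤ I ^ (1 / p) * (C * eLpNorm u (ENNReal.ofReal q) μ) := by
      calc I = ‖inner ℂ v (B u)‖ₑ := e1
        _ ≤ _ := e2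
        _ ≤ (C * I ^ (1 / p)) * eLpNorm u (ENNReal.ofReal q) μ := by
            gcongr
            exact (hB v).trans (by rw [e3])
        _ = _ := by ring
    rcases eq_or_ne I 0 with h0 | h0
    · rw [h0, ENNReal.zero_rpow_of_pos (by positivity)]
      exact zero_le
    · have e5 : I = I ^ (1 / p) * I ^ (1 / q) := by
        rw [← ENNReal.rpow_add _ _ h0 hIfin, one_div, one_div, hpq.inv_add_inv_eq_one,
          ENNReal.rpow_one]
      have h6 : I ^ (1 / p) ≠ 0 := by simp [h0, hIfin]
      have h7 : I ^ (1 / p) ≠ ⊤ := ENNReal.rpow_ne_top_of_nonneg (by positivity) hIfin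
      conv_lhs at e4 => rw [e5]
      exact (ENNReal.mul_le_mul_iff_right h6 h7).1 e4
  rw [eLpNorm_ofReal_eq hq0]
  -- The sets `S N` exhaust `{h ≠ 0}`, so Fatou's lemma removes the truncation.
  have h1 : ∫⁻ x, ENNReal.ofReal (‖h x‖ ^ q) ∂μ ≤
      liminf (fun N => ∫⁻ x in S N, ENNReal.ofReal (‖h x‖ ^ q) ∂μ) atTop := by
    simp_rw [← lintegral_indicator (hS _)]
    refine le_trans (lintegral_mono fun x => ?_) (lintegral_liminf_le fun N =>
      ((mh.norm.measurable.pow_const q).ennreal_ofReal.indicator (hS N)))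
    refine le_of_eq (Tendsto.liminf_eq ?_).symm
    rcases (norm_nonneg (h x)).eq_or_lt with h0 | h0
    · simp [Set.indicator, ← h0, Real.zero_rpow hq0.ne']
    · refine tendsto_const_nhds.congr' ?_
      obtain ⟨N₀, hN₀⟩ := exists_nat_gt (max ‖h x‖ ‖h x‖⁻¹)
      filter_upwards [eventually_ge_atTop N₀] with N hN
      have hN' : (N₀ : ℝ) ≤ N := by exact_mod_cast hN
      have hx : x ∈ S N := by
        constructor
        · refine inv_le_of_inv_le₀ h0 ?_
          linarith [le_max_right ‖h x‖ ‖h x‖⁻¹]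
        · change ‖h x‖ ≤ N + 1
          linarith [le_max_left ‖h x‖ ‖h x‖⁻¹]
      rw [Set.indicator_of_mem hx]
  have h2 : liminf (fun N => ∫⁻ x in S N, ENNReal.ofReal (‖h x‖ ^ q) ∂μ) atTop ≤
      (C * eLpNorm u (ENNReal.ofReal q) μ) ^ q :=
    liminf_le_of_le (by isBoundedDefault) fun b hb =>
      let ⟨N, hN⟩ := hb.exists
      hN.trans (by
        have := ENNReal.rpow_le_rpow (hI N) hq0.le
        rwa [← ENNReal.rpow_mul, one_div_mul_cancel hq0.ne', ENNReal.rpow_one] at this)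
  have h3 := ENNReal.rpow_le_rpow (h1.trans h2) (by positivity : 0 ≤ 1 / q)
  rwa [← ENNReal.rpow_mul, mul_one_div_cancel hq0.ne', ENNReal.rpow_one] at h3

end Limits

end OscMult

namespace OscMult

/-! ### Sobolev norms of oscillating bumps -/

section Sobolev

lemma eLpNorm_fourier_of_smooth {f : ℝ → ℂ} (hf : ContDiff ℝ ∞ f) (hc : HasCompactSupport f) :
    eLpNorm (𝓕 f) 2 volume = eLpNorm f 2 volume := by
  obtain ⟨S, rfl⟩ : ∃ S : SchwartzMap ℝ ℂ, ⇑S = f := ⟨hc.toSchwartzMap hf, rfl⟩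
  have h := SchwartzMap.norm_fourier_toL2_eq S
  rw [SchwartzMap.norm_toLp, SchwartzMap.norm_toLp] at h
  rw [← SchwartzMap.fourier_coe]
  exact (ENNReal.toReal_eq_toReal_iff' ((FourierTransform.fourier S).memLp 2 volume).eLpNorm_ne_top
    (S.memLp 2 volume).eLpNorm_ne_top).1 h

lemma sobolevNorm_of_smooth (s : ℝ≥0) {f : ℝ → ℂ} (hf : ContDiff ℝ ∞ f)
    (hc : HasCompactSupport f) :
    sobolevNorm s f = eLpNorm (fun ξ : ℝ => (1 + ξ ^ 2) ^ ((s : ℝ) / 2) * ‖𝓕 f ξ‖) 2 volume := by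
  obtain ⟨S, rfl⟩ : ∃ S : SchwartzMap ℝ ℂ, ⇑S = f := ⟨hc.toSchwartzMap hf, rfl⟩
  have hm : MemLp S 2 volume := S.memLp 2 volume
  rw [sobolevNorm, dif_pos hm]
  have h1 : (𝓕 (hm.toLp S) : Lp ℂ 2 volume) = (FourierTransform.fourier S).toLp 2 volume :=
    SchwartzMap.toLp_fourier_eq S
  have h2 : (𝓕 (hm.toLp S) : Lp ℂ 2 volume) =ᵐ[volume] 𝓕 (S : ℝ → ℂ) := by
    rw [h1]
    refine (SchwartzMap.coeFn_toLp _ _ _).trans ?_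
    rw [SchwartzMap.fourier_coe]
  refine eLpNorm_congr_ae ?_
  filter_upwards [h2] with ξ hξ
  rw [hξ]

lemma contDiff_iteratedDeriv {f : ℝ → ℂ} (hf : ContDiff ℝ ∞ f) (k : ℕ) :
    ContDiff ℝ ∞ (iteratedDeriv k f) := by
  induction k generalizing f with
  | zero => simpa using hf
  | succ k ih =>
    rw [iteratedDeriv_succ']
    exact ih ((contDiff_infty_iff_deriv.1 hf).2)

lemma tsupport_iteratedDeriv_subset (f : ℝ → ℂ) (k : ℕ) :
    tsupport (iteratedDeriv k f) ⊆ tsupport f := by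
  induction k generalizing f with
  | zero => simp
  | succ k ih =>
    rw [iteratedDeriv_succ']
    exact (ih _).trans tsupport_deriv_subset

/-- Frequencies are measured in units of `R`, and only then is the exponent raised from `s` to `k`.
A function whose `k`-th derivative has size `R^k` thus gets the sharp factor `R^s` also for
fractional `s`, with no interpolation of Sobolev spaces. -/
lemma one_add_sq_rpow_le {s k : ℝ} (hs : 0 ≤ s) (hk : s ≤ k) {R : ℝ} (hR : 1 ≤ R) (ξ : ℝ) :
    (1 + ξ ^ 2) ^ (s / 2) ≤ R ^ s * (2 ^ k * (1 + (|ξ| / R) ^ k)) := by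
  have hR0 : 0 < R := by linarith
  set x := |ξ| / R with hx
  have hx0 : 0 ≤ x := by positivity
  have h1 : 1 + ξ ^ 2 ≤ R ^ 2 * (1 + x) ^ 2 := by
    have : ξ ^ 2 = R ^ 2 * x ^ 2 := by
      rw [hx, div_pow, sq_abs]
      field_simp
    rw [this]
    nlinarith [mul_nonneg (sq_nonneg R) hx0]
  have h2 : (1 + x) ^ k ≤ 2 ^ k * (1 + x ^ k) := by
    have hk0 : 0 ≤ k := hs.trans hk
    have h3 : (1 + x) ^ k ≤ (2 * max 1 x) ^ k :=
      Real.rpow_le_rpow (by positivity) (by linarith [le_max_left 1 x, le_max_right 1 x]) hk0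
    refine h3.trans ?_
    rw [Real.mul_rpow (by positivity) (by positivity)]
    gcongr
    rcases le_total 1 x with h | h
    · rw [max_eq_right h]
      linarith
    · rw [max_eq_left h, Real.one_rpow]
      linarith [Real.rpow_nonneg hx0 k]
  calc (1 + ξ ^ 2) ^ (s / 2) ≤ (R ^ 2 * (1 + x) ^ 2) ^ (s / 2) := by gcongr
    _ = R ^ s * (1 + x) ^ s := by
        rw [← mul_pow, ← Real.rpow_natCast, ← Real.rpow_mul (by positivity),
          Real.mul_rpow hR0.le (by positivity)]
        congr 2 <;> (push_cast; ring)
    _ ≤ R ^ s * (1 + x) ^ k := by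
        gcongr
        linarith
    _ ≤ _ := by gcongr

lemma sobolevNorm_le {s : ℝ≥0} {k : ℕ} (hk : (s : ℝ) ≤ k) {R : ℝ} (hR : 1 ≤ R) {f : ℝ → ℂ}
    (hf : ContDiff ℝ ∞ f) (hc : HasCompactSupport f) :
    sobolevNorm s f ≤ ENNReal.ofReal (R ^ (s : ℝ) * 2 ^ k) *
      (eLpNorm f 2 volume + ENNReal.ofReal (R ^ k)⁻¹ * eLpNorm (iteratedDeriv k f) 2 volume) := by
  have hR0 : 0 < R := by linarith
  have hcs : ∀ n, HasCompactSupport (iteratedDeriv n f) := fun n =>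
    hc.of_isClosed_subset isClosed_closure (tsupport_iteratedDeriv_subset f n)
  have hF : 𝓕 (iteratedDeriv k f) = fun x : ℝ => (2 * Real.pi * Complex.I * x) ^ k • 𝓕 f x :=
    Real.fourier_iteratedDeriv (N := (⊤ : ℕ∞)) hf
      (fun n _ => (contDiff_iteratedDeriv hf n).continuous.integrable_of_hasCompactSupport (hcs n))
      le_top
  have hmeas : ∀ {g : ℝ → ℂ}, ContDiff ℝ ∞ g → HasCompactSupport g →
      AEStronglyMeasurable (𝓕 g) volume := fun {g} hg hg' =>
    (by
      rw [← SchwartzMap.fourier_coe (hg'.toSchwartzMap hg)]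
      exact (SchwartzMap.continuous _).aestronglyMeasurable :
      AEStronglyMeasurable (𝓕 (hg'.toSchwartzMap hg : ℝ → ℂ)) volume)
  have m1 := hmeas hf hc
  have m2 := hmeas (contDiff_iteratedDeriv hf k) (hcs k)
  rw [sobolevNorm_of_smooth s hf hc]
  calc _ ≤ eLpNorm (fun ξ : ℝ => (R ^ (s : ℝ) * 2 ^ k) • (‖𝓕 f ξ‖ +
        (R ^ k)⁻¹ • ‖𝓕 (iteratedDeriv k f) ξ‖)) 2 volume := by
        refine eLpNorm_mono_real fun ξ => ?_
        rw [Real.norm_of_nonneg (by positivity), hF, norm_smul, norm_pow, smul_eq_mul, smul_eq_mul]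
        have h1 := one_add_sq_rpow_le s.2 hk hR ξ
        rw [Real.rpow_natCast, Real.rpow_natCast] at h1
        -- The factor `2π` from the normalization of the Fourier transform only helps.
        have h2 : |ξ| ^ k ≤ ‖(2 * Real.pi * Complex.I * ξ : ℂ)‖ ^ k := by
          gcongr
          simp only [norm_mul, Complex.norm_I, Complex.norm_real, Real.norm_eq_abs,
            Complex.norm_ofNat, mul_one]
          rw [abs_of_pos Real.pi_pos]
          nlinarith [abs_nonneg ξ, Real.pi_gt_three]
        calc _ ≤ (R ^ (s : ℝ) * (2 ^ k * (1 + (|ξ| / R) ^ k))) * ‖𝓕 f ξ‖ := by gcongr; exact h1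
          _ = (R ^ (s : ℝ) * 2 ^ k) * (‖𝓕 f ξ‖ + (R ^ k)⁻¹ * (|ξ| ^ k * ‖𝓕 f ξ‖)) := by
              rw [div_pow]; field_simp
          _ ≤ _ := by gcongr
    _ = ENNReal.ofReal (R ^ (s : ℝ) * 2 ^ k) * eLpNorm (fun ξ : ℝ => ‖𝓕 f ξ‖ +
        (R ^ k)⁻¹ • ‖𝓕 (iteratedDeriv k f) ξ‖) 2 volume := by
        rw [show (fun ξ : ℝ => (R ^ (s : ℝ) * 2 ^ k) • (‖𝓕 f ξ‖ +
          (R ^ k)⁻¹ • ‖𝓕 (iteratedDeriv k f) ξ‖)) = (R ^ (s : ℝ) * 2 ^ k) • (fun ξ : ℝ => ‖𝓕 f ξ‖ +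
          (R ^ k)⁻¹ • ‖𝓕 (iteratedDeriv k f) ξ‖) from rfl, eLpNorm_const_smul,
          Real.enorm_of_nonneg (by positivity)]
    _ ≤ ENNReal.ofReal (R ^ (s : ℝ) * 2 ^ k) * (eLpNorm (fun ξ : ℝ => ‖𝓕 f ξ‖) 2 volume +
        eLpNorm ((R ^ k)⁻¹ • fun ξ : ℝ => ‖𝓕 (iteratedDeriv k f) ξ‖) 2 volume) := by
        gcongr
        exact eLpNorm_add_le m1.norm (m2.norm.const_smul (R ^ k)⁻¹) one_le_two
    _ = _ := by
        rw [eLpNorm_const_smul, eLpNorm_norm, eLpNorm_norm, eLpNorm_fourier_of_smooth hf hc,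
          eLpNorm_fourier_of_smooth (contDiff_iteratedDeriv hf k) (hcs k),
          Real.enorm_of_nonneg (by positivity)]

/-- Smooth functions with compact support in `(0, ∞)`. -/
structure IsBump (ψ : ℝ → ℂ) : Prop where
  contDiff : ContDiff ℝ ∞ ψ
  compact : HasCompactSupport ψ
  pos : tsupport ψ ⊆ Set.Ioi 0

lemma IsBump.mul_of_contDiffAt {ψ g : ℝ → ℂ} (h : IsBump ψ)
    (hg : ∀ l, 0 < l → ContDiffAt ℝ ∞ g l) : IsBump fun l => g l * ψ l := by
  have hs : tsupport (fun l => g l * ψ l) ⊆ tsupport ψ := tsupport_mul_subset_right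
  refine ⟨contDiff_iff_contDiffAt.2 fun l => ?_, h.compact.mul_left, hs.trans h.pos⟩
  by_cases hl : l ∈ tsupport ψ
  · exact (hg l (h.pos hl)).mul h.contDiff.contDiffAt
  · exact contDiffAt_const (c := (0:ℂ)) |>.congr_of_eventuallyEq
      (notMem_tsupport_iff_eventuallyEq.1 fun h' => hl (hs h'))

lemma IsBump.deriv {ψ : ℝ → ℂ} (h : IsBump ψ) : IsBump (deriv ψ) :=
  ⟨(contDiff_infty_iff_deriv.1 h.contDiff).2, h.compact.deriv,
    tsupport_deriv_subset.trans h.pos⟩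

lemma contDiffAt_rpow_ofReal (a : ℝ) {l : ℝ} (hl : 0 < l) :
    ContDiffAt ℝ ∞ (fun l : ℝ => ((l ^ a : ℝ) : ℂ)) l :=
  Complex.ofRealCLM.contDiff.contDiffAt.comp l (Real.contDiffAt_rpow_const_of_ne hl.ne')

/-- The oscillating function `l ↦ e^{i R l^θ}`. -/
noncomputable def osc (θ R l : ℝ) : ℂ := Complex.exp (Complex.I * ((R * l ^ θ : ℝ) : ℂ))

lemma norm_osc (θ R l : ℝ) : ‖osc θ R l‖ = 1 := by
  rw [osc, mul_comm, Complex.norm_exp_ofReal_mul_I]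

lemma contDiffAt_osc (θ R : ℝ) {l : ℝ} (hl : 0 < l) : ContDiffAt ℝ ∞ (osc θ R) l := by
  unfold osc
  simp_rw [Complex.ofReal_mul]
  exact (contDiffAt_const.mul (contDiffAt_const.mul (contDiffAt_rpow_ofReal θ hl))).cexp

lemma IsBump.osc {ψ : ℝ → ℂ} (h : IsBump ψ) (θ R : ℝ) : IsBump fun l => osc θ R l * ψ l :=
  h.mul_of_contDiffAt fun _ hl => contDiffAt_osc θ R hl

lemma IsBump.rpow {ψ : ℝ → ℂ} (h : IsBump ψ) (a : ℝ) :
    IsBump fun l => ((l ^ a : ℝ) : ℂ) * ψ l :=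
  h.mul_of_contDiffAt fun _ hl => contDiffAt_rpow_ofReal a hl

/-- The derivative is again a combination of oscillating bumps with the same phase, the bumps being
independent of `R`; this drives the induction on derivatives. Away from the support of `ψ`, where
`l^θ` need not be smooth, both sides vanish. -/
lemma deriv_osc_mul {ψ : ℝ → ℂ} (h : IsBump ψ) (θ R l : ℝ) :
    deriv (fun l => osc θ R l * ψ l) l = osc θ R l * deriv ψ l +
      R * (osc θ R l * (((l ^ (θ - 1) : ℝ) : ℂ) * (Complex.I * θ * ψ l))) := by
  by_cases hl : l ∈ tsupport ψ
  · have hl0 : l ≠ 0 := (h.pos hl).ne'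
    have h1 : HasDerivAt (fun l : ℝ => ((R * l ^ θ : ℝ) : ℂ)) ((R * (θ * l ^ (θ - 1)) : ℝ) : ℂ) l :=
      (((Real.hasDerivAt_rpow_const (Or.inl hl0)).const_mul R)).ofReal_comp
    have h2 := ((h1.const_mul Complex.I).cexp).mul
      (h.contDiff.differentiable (by simp) l).hasDerivAt
    have h3 : deriv (fun l => OscMult.osc θ R l * ψ l) l = _ := h2.deriv
    rw [h3]
    unfold OscMult.osc
    push_cast
    ring
  · have h1 := notMem_tsupport_iff_eventuallyEq.1 hl
    have h2 : (fun l => OscMult.osc θ R l * ψ l) =ᶠ[𝓝 l] fun _ => 0 :=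
      h1.mono fun x hx => by simp [hx]
    rw [h2.deriv_eq, h1.deriv_eq, h1.eq_of_nhds]
    simp

lemma norm_iteratedDeriv_osc_le (θ : ℝ) (k : ℕ) {ψ : ℝ → ℂ} (h : IsBump ψ) :
    ∃ C : ℝ, 0 ≤ C ∧ ∀ R : ℝ, 1 ≤ |R| → ∀ l,
      ‖iteratedDeriv k (fun l => osc θ R l * ψ l) l‖ ≤ C * |R| ^ k := by
  -- Both bumps produced by one differentiation enter the induction, so `ψ` must vary; `|R| ≥ 1`
  -- absorbs the term that gains no power of `R`.
  induction k generalizing ψ with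
  | zero =>
    obtain ⟨C, hC⟩ := h.contDiff.continuous.bounded_above_of_compact_support h.compact
    refine ⟨C, (norm_nonneg _).trans (hC 0), fun R _ l => ?_⟩
    simpa [norm_osc] using hC l
  | succ k ih =>
    have hψ₁ : IsBump fun l => ((l ^ (θ - 1) : ℝ) : ℂ) * (Complex.I * θ * ψ l) :=
      (h.mul_of_contDiffAt (g := fun _ => Complex.I * θ) fun _ _ => contDiffAt_const).rpow _
    obtain ⟨C₁, hC₁, H₁⟩ := ih h.deriv
    obtain ⟨C₂, hC₂, H₂⟩ := ih hψ₁
    refine ⟨C₁ + C₂, by positivity, fun R hR l => ?_⟩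
    have c₁ := (h.deriv.osc θ R).contDiff
    have c₂ := (hψ₁.osc θ R).contDiff
    have e : deriv (fun l => osc θ R l * ψ l) = (fun l => osc θ R l * deriv ψ l) +
        fun l => (R : ℂ) * (osc θ R l * (((l ^ (θ - 1) : ℝ) : ℂ) * (Complex.I * θ * ψ l))) :=
      funext fun l => deriv_osc_mul h θ R l
    have hk : ((k : ℕ∞) : WithTop ℕ∞) ≤ ((⊤ : ℕ∞) : WithTop ℕ∞) := by exact_mod_cast le_top
    rw [iteratedDeriv_succ', e, iteratedDeriv_add (c₁.of_le hk).contDiffAt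
      ((contDiff_const.mul c₂).of_le hk).contDiffAt, iteratedDeriv_const_mul_field]
    refine (norm_add_le _ _).trans ?_
    rw [norm_mul, Complex.norm_real, Real.norm_eq_abs]
    calc _ ≤ C₁ * |R| ^ k + |R| * (C₂ * |R| ^ k) := by
          gcongr
          · exact H₁ R hR l
          · exact H₂ R hR l
      _ ≤ C₁ * |R| ^ (k + 1) + |R| * (C₂ * |R| ^ k) := by
          gcongr
          omega
      _ = _ := by ring

lemma eLpNorm_two_le_of_bound {f : ℝ → ℂ} {K : Set ℝ} (hK : IsCompact K) (hf : tsupport f ⊆ K)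
    {C : ℝ} (hC : ∀ l, ‖f l‖ ≤ C) :
    eLpNorm f 2 volume ≤ ENNReal.ofReal C * volume K ^ (1 / 2 : ℝ) := by
  have h0 : 0 ≤ C := (norm_nonneg _).trans (hC 0)
  have h1 : eLpNorm f 2 volume ≤ eLpNorm (K.indicator fun _ => C) 2 volume := by
    refine eLpNorm_mono_real fun l => ?_
    by_cases hl : l ∈ K
    · simpa [hl] using hC l
    · have : f l = 0 := image_eq_zero_of_notMem_tsupport fun h => hl (hf h)
      simp [hl, this]
  refine h1.trans ?_
  rw [eLpNorm_indicator_const hK.measurableSet two_ne_zero ENNReal.ofNat_ne_top,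
    Real.enorm_of_nonneg h0, ENNReal.toReal_ofNat]

/-- The Sobolev norm of order `s` of an oscillating bump grows like `|R| ^ s`. -/
lemma sobolevNorm_osc_le (θ : ℝ) (s : ℝ≥0) {ψ : ℝ → ℂ} (h : IsBump ψ) :
    ∃ C : ℝ, 0 ≤ C ∧ ∀ R : ℝ, 1 ≤ |R| →
      sobolevNorm s (fun l => osc θ R l * ψ l) ≤ ENNReal.ofReal (C * |R| ^ (s : ℝ)) := by
  obtain ⟨k, hk⟩ := exists_nat_ge (s : ℝ)
  obtain ⟨C₀, hC₀, H₀⟩ := norm_iteratedDeriv_osc_le θ 0 h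
  obtain ⟨C₁, hC₁, H₁⟩ := norm_iteratedDeriv_osc_le θ k h
  let V := volume (tsupport ψ) ^ (1 / 2 : ℝ)
  have hV : V ≠ ⊤ := ENNReal.rpow_ne_top_of_nonneg (by norm_num) h.compact.measure_lt_top.ne
  refine ⟨2 ^ k * ((C₀ + C₁) * V.toReal), by positivity, fun R hR => ?_⟩
  have hR0 : 0 < |R| := by linarith
  have hs : ∀ n, tsupport (iteratedDeriv n fun l => osc θ R l * ψ l) ⊆ tsupport ψ := fun n =>
    (tsupport_iteratedDeriv_subset _ n).trans tsupport_mul_subset_right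
  have e₀ := eLpNorm_two_le_of_bound h.compact (hs 0) (H₀ R hR)
  have e₁ := eLpNorm_two_le_of_bound h.compact (hs k) (H₁ R hR)
  rw [iteratedDeriv_zero, pow_zero, mul_one] at e₀
  refine (sobolevNorm_le hk hR (h.osc θ R).contDiff (h.osc θ R).compact).trans ?_
  calc _ ≤ ENNReal.ofReal (|R| ^ (s : ℝ) * 2 ^ k) * (ENNReal.ofReal C₀ * V +
        ENNReal.ofReal (|R| ^ k)⁻¹ * (ENNReal.ofReal (C₁ * |R| ^ k) * V)) := by gcongr
    _ = _ := by
        rw [← ENNReal.ofReal_toReal hV]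
        rw [← ENNReal.ofReal_mul (by positivity), ← ENNReal.ofReal_mul (by positivity),
          ← ENNReal.ofReal_mul (by positivity), ← ENNReal.ofReal_add (by positivity)
          (by positivity), ← ENNReal.ofReal_mul (by positivity), ENNReal.toReal_ofReal
          (by positivity)]
        congr 1
        field_simp

end Sobolev

end OscMult

namespace OscMult

/-! ### Left-invariant derivatives and the sublaplacian -/

section SmoothFields

variable {E : Type*} [NormedAddCommGroup E] [NormedSpace ℝ E]
  {G : Type*} [TopologicalSpace G] [ChartedSpace E G] [Group G] [LieGroup 𝓘(ℝ, E) ∞ G]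

/-- The field at `g` is the differential of the product map at `(g, 1)` applied to `(0, v)`, hence a
composition of smooth maps between tangent bundles. -/
lemma contMDiff_infty_mulInvariantVectorField (v : GroupLieAlgebra 𝓘(ℝ, E) G) :
    ContMDiff 𝓘(ℝ, E) 𝓘(ℝ, E).tangent ∞
      (fun g : G => (⟨g, mulInvariantVectorField v g⟩ : TangentBundle 𝓘(ℝ, E) G)) := by
  let fg : G → TangentBundle 𝓘(ℝ, E) G := fun g => Bundle.TotalSpace.mk' E g 0
  have sfg : ContMDiff 𝓘(ℝ, E) 𝓘(ℝ, E).tangent ∞ fg := Bundle.contMDiff_zeroSection _ _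
  let fv : G → TangentBundle 𝓘(ℝ, E) G := fun _ => Bundle.TotalSpace.mk' E 1 v
  have sfv : ContMDiff 𝓘(ℝ, E) 𝓘(ℝ, E).tangent ∞ fv := contMDiff_const
  have S₁ := sfg.prodMk sfv
  let F₂ : (TangentBundle 𝓘(ℝ, E) G × TangentBundle 𝓘(ℝ, E) G) →
      TangentBundle (𝓘(ℝ, E).prod 𝓘(ℝ, E)) (G × G) :=
    (equivTangentBundleProd 𝓘(ℝ, E) G 𝓘(ℝ, E) G).symm
  have S₂ : ContMDiff _ _ ∞ F₂ := contMDiff_equivTangentBundleProd_symm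
  let F₃ : TangentBundle (𝓘(ℝ, E).prod 𝓘(ℝ, E)) (G × G) → TangentBundle 𝓘(ℝ, E) G :=
    tangentMap (𝓘(ℝ, E).prod 𝓘(ℝ, E)) 𝓘(ℝ, E) (fun p : G × G => p.1 * p.2)
  have S₃ : ContMDiff _ _ ∞ F₃ :=
    (contMDiff_mul 𝓘(ℝ, E) ∞).contMDiff_tangentMap (m := ∞) le_rfl
  let S := (S₃.comp S₂).comp S₁
  convert! S with g
  · simp [F₂, F₃, fg, fv]
  · simp only [Function.comp_apply, tangentMap, F₃, F₂, fg, fv]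
    rw [mfderiv_prod_eq_add_apply ((contMDiff_mul 𝓘(ℝ, E) ∞).mdifferentiableAt (by simp))]
    have aux (A B : E →L[ℝ] E) (w : E) : B w = A 0 + B w := by rw [map_zero, zero_add]
    exact aux (mfderiv 𝓘(ℝ, E) 𝓘(ℝ, E) (fun z : G => z * 1) g)
      (mfderiv 𝓘(ℝ, E) 𝓘(ℝ, E) (fun z : G => g * z) 1) v

lemma contMDiff_leftDeriv (v : GroupLieAlgebra 𝓘(ℝ, E) G) {f : G → ℂ}
    (hf : ContMDiff 𝓘(ℝ, E) 𝓘(ℝ, ℂ) ∞ f) : ContMDiff 𝓘(ℝ, E) 𝓘(ℝ, ℂ) ∞ (leftDeriv v f) := by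
  have h1 := (hf.contMDiff_tangentMap (m := ∞) le_rfl).comp
    (contMDiff_infty_mulInvariantVectorField v)
  exact (contMDiff_snd_tangentBundle_modelSpace ℂ 𝓘(ℝ, ℂ)).comp h1

lemma leftDeriv_const_mul (v : GroupLieAlgebra 𝓘(ℝ, E) G) {f : G → ℂ}
    (hf : ContMDiff 𝓘(ℝ, E) 𝓘(ℝ, ℂ) ∞ f) (c : ℂ) :
    leftDeriv v (fun x => c * f x) = fun x => c * leftDeriv v f x := by
  ext x
  have h1 : HasMFDerivAt 𝓘(ℝ, E) 𝓘(ℝ, ℂ) f x (mfderiv 𝓘(ℝ, E) 𝓘(ℝ, ℂ) f x) :=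
    ((hf x).mdifferentiableAt (by simp)).hasMFDerivAt
  have h2 := ((ContinuousLinearMap.mul ℝ ℂ c).hasMFDerivAt (x := f x)).comp x h1
  have h3 : mfderiv 𝓘(ℝ, E) 𝓘(ℝ, ℂ) (fun x => c * f x) x = _ := h2.mfderiv
  unfold leftDeriv
  rw [h3]
  rfl

variable {n : ℕ} {X : Fin n → GroupLieAlgebra 𝓘(ℝ, E) G}

lemma sublaplacian_const_mul {f : G → ℂ} (hf : ContMDiff 𝓘(ℝ, E) 𝓘(ℝ, ℂ) ∞ f) (c : ℂ) (x : G) :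
    sublaplacian X (fun x => c * f x) x = c * sublaplacian X f x := by
  unfold sublaplacian
  simp_rw [leftDeriv_const_mul _ hf, leftDeriv_const_mul _ (contMDiff_leftDeriv _ hf)]
  rw [← Finset.mul_sum, mul_neg]

lemma sublaplacian_comp {r : ℝ} {δ : G → G}
    (hδ : ∀ (j : Fin n) (f : G → ℂ) (x : G), ContMDiff 𝓘(ℝ, E) 𝓘(ℝ, ℂ) ∞ f →
      leftDeriv (X j) (f ∘ δ) x = r * leftDeriv (X j) f (δ x))
    (hs : ContMDiff 𝓘(ℝ, E) 𝓘(ℝ, E) ∞ δ) {f : G → ℂ} (hf : ContMDiff 𝓘(ℝ, E) 𝓘(ℝ, ℂ) ∞ f) (x : G) :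
    sublaplacian X (f ∘ δ) x = (r ^ 2 : ℝ) * sublaplacian X f (δ x) := by
  unfold sublaplacian
  have h1 : ∀ j, leftDeriv (X j) (f ∘ δ) = fun x => (r : ℂ) * (leftDeriv (X j) f ∘ δ) x :=
    fun j => funext fun x => hδ j f x hf
  simp_rw [h1]
  rw [mul_neg, Finset.mul_sum]
  congr 1
  refine Finset.sum_congr rfl fun j _ => ?_
  rw [leftDeriv_const_mul _ ((contMDiff_leftDeriv _ hf).comp hs)]
  simp only
  rw [hδ j _ x (contMDiff_leftDeriv _ hf)]
  push_cast
  ring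

end SmoothFields

/-! ### Unitary action of maps that scale the measure -/

section Unitary

variable {X : Type*} [MeasurableSpace X] {μ : Measure X}

lemma eLpNorm_comp_equiv (δ : X ≃ᵐ X) {m : ℝ≥0} (h : μ.map δ = m • μ) {p : ℝ≥0∞} (hp : p ≠ ⊤)
    (f : X → ℂ) :
    eLpNorm (fun x => f (δ x)) p μ = (m : ℝ≥0∞) ^ (1 / p).toReal * eLpNorm f p μ := by
  rw [← smul_eq_mul, ← eLpNorm_smul_measure_of_ne_top hp f (m : ℝ≥0∞),
    show (m : ℝ≥0∞) • μ = m • μ from rfl, ← h, δ.measurableEmbedding.eLpNorm_map_measure]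
  rfl

lemma memLp_comp_equiv (δ : X ≃ᵐ X) {m : ℝ≥0} (h : μ.map δ = m • μ) {p : ℝ≥0∞}
    {f : X → ℂ} (hf : MemLp f p μ) : MemLp (fun x => f (δ x)) p μ := by
  have h1 : MemLp f p (m • μ) := hf.smul_measure (c := m) ENNReal.coe_ne_top
  rw [← h, δ.measurableEmbedding.memLp_map_measure_iff] at h1
  exact h1

/-- The action on `L²` of a measurable automorphism which multiplies the measure by `m`. -/
lemma exists_unitary (δ : X ≃ᵐ X) {m : ℝ≥0} (hm : 0 < m) (h : μ.map δ = m • μ) :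
    ∃ (k : ℝ) (U : Lp ℂ 2 μ ≃ₗᵢ[ℂ] Lp ℂ 2 μ), 0 < k ∧
      (∀ u, U u =ᵐ[μ] fun x => (k : ℂ) * u (δ x)) ∧
      (∀ u, U.symm u =ᵐ[μ] fun x => ((k⁻¹ : ℝ) : ℂ) * u (δ.symm x)) := by
  have hac : ∀ {c : ℝ≥0}, (c • μ) ≪ μ := fun {c} => Measure.smul_absolutelyContinuous
  have h' : μ.map δ.symm = m⁻¹ • μ := by
    have h1 : μ = m • μ.map δ.symm := by
      rw [← Measure.map_smul, ← h, δ.map_symm_map]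
    conv_rhs => rw [h1]
    rw [smul_smul, inv_mul_cancel₀ hm.ne', one_smul]
  have q : Measure.QuasiMeasurePreserving δ μ μ := ⟨δ.measurable, by rw [h]; exact hac⟩
  have q' : Measure.QuasiMeasurePreserving δ.symm μ μ :=
    ⟨δ.symm.measurable, by rw [h']; exact hac⟩
  -- Composition with `δ` multiplies the squared `L²` norm by `m`, and `k` compensates for it.
  let k : ℝ := (√m)⁻¹
  have hk : 0 < k := inv_pos.2 (Real.sqrt_pos.2 hm)
  have mem : ∀ (u : Lp ℂ 2 μ), MemLp (fun x => (k : ℂ) * u (δ x)) 2 μ := fun u =>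
    (memLp_comp_equiv δ h (Lp.memLp u)).const_mul _
  have mem' : ∀ (u : Lp ℂ 2 μ), MemLp (fun x => ((k⁻¹ : ℝ) : ℂ) * u (δ.symm x)) 2 μ := fun u =>
    (memLp_comp_equiv δ.symm h' (Lp.memLp u)).const_mul _
  let L : Lp ℂ 2 μ ≃ₗ[ℂ] Lp ℂ 2 μ :=
    { toFun := fun u => (mem u).toLp _
      invFun := fun u => (mem' u).toLp _
      map_add' := fun u v => by
        ext1
        filter_upwards [(mem (u + v)).coeFn_toLp, (mem u).coeFn_toLp, (mem v).coeFn_toLp,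
          Lp.coeFn_add ((mem u).toLp _) ((mem v).toLp _), q.ae (Lp.coeFn_add u v)]
          with x h1 h2 h3 h4 h5
        rw [h1, h4, Pi.add_apply, h2, h3, h5, Pi.add_apply, mul_add]
      map_smul' := fun c u => by
        ext1
        filter_upwards [(mem (c • u)).coeFn_toLp, (mem u).coeFn_toLp,
          Lp.coeFn_smul c ((mem u).toLp _), q.ae (Lp.coeFn_smul c u)] with x h1 h2 h3 h4
        rw [h1, RingHom.id_apply, h3, Pi.smul_apply, h2, h4, Pi.smul_apply, smul_eq_mul,
          smul_eq_mul]
        ring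
      left_inv := fun u => by
        ext1
        filter_upwards [(mem' ((mem u).toLp _)).coeFn_toLp, q'.ae (mem u).coeFn_toLp] with x h1 h2
        rw [h1, h2, δ.apply_symm_apply, ← mul_assoc, ← Complex.ofReal_mul,
          inv_mul_cancel₀ hk.ne', Complex.ofReal_one, one_mul]
      right_inv := fun u => by
        ext1
        filter_upwards [(mem ((mem' u).toLp _)).coeFn_toLp, q.ae (mem' u).coeFn_toLp] with x h1 h2
        rw [h1, h2, δ.symm_apply_apply, ← mul_assoc, ← Complex.ofReal_mul,
          mul_inv_cancel₀ hk.ne', Complex.ofReal_one, one_mul] }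
  refine ⟨k, ⟨L, fun u => ?_⟩, hk, fun u => (mem u).coeFn_toLp, fun u => (mem' u).coeFn_toLp⟩
  change ‖(mem u).toLp _‖ = ‖u‖
  rw [Lp.norm_toLp, Lp.norm_def]
  congr 1
  have : (fun x => (k : ℂ) * u (δ x)) = (k : ℂ) • fun x => u (δ x) := rfl
  rw [this, eLpNorm_const_smul, eLpNorm_comp_equiv δ h ENNReal.ofNat_ne_top, ← mul_assoc]
  have h2 : ‖(k : ℂ)‖ₑ * (m : ℝ≥0∞) ^ (1 / 2 : ℝ≥0∞).toReal = 1 := by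
    rw [← ofReal_norm, Complex.norm_real, Real.norm_of_nonneg hk.le,
      ← ENNReal.ofReal_coe_nnreal, ENNReal.ofReal_rpow_of_nonneg m.coe_nonneg ENNReal.toReal_nonneg,
      ← ENNReal.ofReal_mul hk.le]
    have h3 : (m : ℝ) ^ (1 / 2 : ℝ≥0∞).toReal = √m := by
      rw [Real.sqrt_eq_rpow]
      simp
    have h4 : k * √m = 1 := inv_mul_cancel₀ (Real.sqrt_pos.2 hm).ne'
    rw [h3, h4, ENNReal.ofReal_one]
  rw [h2, one_mul]

end Unitary

/-! ### Automorphisms scale a right Haar measure -/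

section Haar

variable {G : Type*} [TopologicalSpace G] [Group G] [IsTopologicalGroup G] [LocallyCompactSpace G]
  [T2Space G] [SecondCountableTopology G] [MeasurableSpace G] [BorelSpace G]

/-- Inversion turns `μ` into a left Haar measure, for which an automorphism has a modulus by
uniqueness; automorphisms commute with inversion, so the scaling carries back. -/
lemma exists_map_eq_smul (μ : Measure G) [μ.IsMulRightInvariant] [IsFiniteMeasureOnCompacts μ]
    [μ.IsOpenPosMeasure] (δ : G ≃ₜ* G) : ∃ m : ℝ≥0, 0 < m ∧ μ.map δ = m • μ := by
  have hop : μ.inv.IsOpenPosMeasure :=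
    (Homeomorph.inv G).continuous.isOpenPosMeasure_map (Homeomorph.inv G).surjective
  have hfin : IsFiniteMeasureOnCompacts μ.inv :=
    ⟨fun K hK => by rw [Measure.inv_apply]; exact hK.inv.measure_lt_top⟩
  have : μ.inv.IsHaarMeasure := { }
  have hc := mulEquivHaarChar_smul_map μ.inv δ
  set c := mulEquivHaarChar δ
  have hc0 : 0 < c := mulEquivHaarChar_pos δ
  have hcomm : μ.inv.map δ = (μ.map δ).inv := by
    have hδ : Measurable δ := δ.continuous.measurable
    rw [Measure.inv, Measure.inv, Measure.map_map hδ measurable_inv,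
      Measure.map_map measurable_inv hδ]
    congr 1
    ext x
    simp
  refine ⟨c⁻¹, inv_pos.2 hc0, ?_⟩
  have h1 : (μ.map δ).inv = c⁻¹ • μ.inv := by
    conv_rhs => rw [← hc]
    rw [smul_smul, inv_mul_cancel₀ hc0.ne', one_smul, hcomm]
  have h2 := congrArg Measure.inv h1
  rw [Measure.inv_inv] at h2
  rw [h2, Measure.inv, Measure.map_smul]
  congr 1
  exact Measure.inv_inv μ

end Haar

end OscMult

namespace OscMult

/-! ### Group dilations acting on the sublaplacian and on multipliers -/

section Group

variable {H : Type*} [NormedAddCommGroup H] [InnerProductSpace ℂ H] [CompleteSpace H]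

/-- Invariance need only be checked on the core: it passes to the span by linearity and to the
closure by continuity. -/
lemma closedGraph_stable {D : Set (H × H)} (U : H →L[ℂ] H) (a : ℂ)
    (hD : ∀ w ∈ D, (U w.1, a • U w.2) ∈ D) {x y : H}
    (h : WithLp.toLp 2 (x, y) ∈ closedGraph D) :
    WithLp.toLp 2 (U x, a • U y) ∈ closedGraph D := by
  let e := WithLp.prodContinuousLinearEquiv 2 ℂ H H
  let Φ : WithLp 2 (H × H) →L[ℂ] WithLp 2 (H × H) :=
    e.symm.toContinuousLinearMap ∘L (U.prodMap (a • U)) ∘L e.toContinuousLinearMap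
  have hΦ : ∀ x y, Φ (WithLp.toLp 2 (x, y)) = WithLp.toLp 2 (U x, a • U y) := fun _ _ => rfl
  rw [← hΦ]
  have hspan : Submodule.span ℂ ((WithLp.toLp 2) '' D) ≤
      (Submodule.span ℂ ((WithLp.toLp 2) '' D)).comap (Φ : WithLp 2 (H × H) →ₗ[ℂ] _) := by
    rw [Submodule.span_le]
    rintro _ ⟨w, hw, rfl⟩
    exact Submodule.subset_span ⟨_, hD w hw, rfl⟩
  exact map_mem_closure Φ.continuous h hspan

variable {E : Type*} [NormedAddCommGroup E] [NormedSpace ℝ E]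
  {G : Type*} [TopologicalSpace G] [ChartedSpace E G] [Group G] [LieGroup 𝓘(ℝ, E) ∞ G]
  [MeasurableSpace G] {μ : Measure G} {n : ℕ} {X : Fin n → GroupLieAlgebra 𝓘(ℝ, E) G}

lemma sublaplacianGraph_stable {r : ℝ} {δ : G → G} (hδh : Topology.IsClosedEmbedding δ)
    (q : Measure.QuasiMeasurePreserving δ μ μ)
    (hδ : ∀ (j : Fin n) (f : G → ℂ) (x : G), ContMDiff 𝓘(ℝ, E) 𝓘(ℝ, ℂ) ∞ f →
      leftDeriv (X j) (f ∘ δ) x = r * leftDeriv (X j) f (δ x))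
    (hs : ContMDiff 𝓘(ℝ, E) 𝓘(ℝ, E) ∞ δ) {U : Lp ℂ 2 μ →L[ℂ] Lp ℂ 2 μ} (k : ℂ)
    (hU : ∀ u, U u =ᵐ[μ] fun x => k * u (δ x)) :
    ∀ w ∈ sublaplacianGraph μ X, (U w.1, ((r ^ 2 : ℝ) : ℂ) • U w.2) ∈ sublaplacianGraph μ X := by
  rintro ⟨u, v⟩ ⟨f, hf, hc, hu, hv⟩
  refine ⟨fun x => k * f (δ x), (ContinuousLinearMap.mul ℝ ℂ k).contMDiff.comp (hf.comp hs),
    (hc.comp_isClosedEmbedding hδh).mul_left, ?_, ?_⟩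
  · filter_upwards [hU u, q.ae hu] with x h1 h2
    rw [h1, h2]
  · filter_upwards [hU v, q.ae hv, Lp.coeFn_smul ((r ^ 2 : ℝ) : ℂ) (U v)] with x h1 h2 h3
    have h4 := sublaplacian_const_mul (X := X) (hf.comp hs) k x
    simp only [Function.comp_apply] at h4
    rw [h3, Pi.smul_apply, h1, h2, h4]
    change _ = k * sublaplacian X (f ∘ δ) x
    rw [sublaplacian_comp hδ hs hf, smul_eq_mul]
    ring

variable [FiniteDimensional ℝ E] [T2Space G] [SecondCountableTopology G] [BorelSpace G]
  [μ.IsMulRightInvariant] [IsFiniteMeasureOnCompacts μ] [μ.IsOpenPosMeasure]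

/-- The normalization is that of `L²`, so `L¹` norms are multiplied by a constant `c`. Its value is
irrelevant, because only conjugation by `U` is used. -/
lemma exists_dilation_unitary (hX : IsStratified X) {r : ℝ} (hr : 0 < r) :
    ∃ (c : ℝ≥0∞) (U : Lp ℂ 2 μ ≃ₗᵢ[ℂ] Lp ℂ 2 μ), c ≠ 0 ∧ c ≠ ⊤ ∧
      (∀ u, eLpNorm (U u) 1 μ = c * eLpNorm u 1 μ) ∧
      (∀ x y, WithLp.toLp 2 (x, y) ∈ closedGraph (sublaplacianGraph μ X) →
        WithLp.toLp 2 (U x, ((r ^ 2 : ℝ) : ℂ) • U y) ∈ closedGraph (sublaplacianGraph μ X)) ∧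
      (∀ x y, WithLp.toLp 2 (x, y) ∈ closedGraph (sublaplacianGraph μ X) →
        WithLp.toLp 2 (U.symm x, (((r ^ 2)⁻¹ : ℝ) : ℂ) • U.symm y) ∈
          closedGraph (sublaplacianGraph μ X)) := by
  have : IsTopologicalGroup G := topologicalGroup_of_lieGroup 𝓘(ℝ, E) ∞
  have : LocallyCompactSpace G := Manifold.locallyCompact_of_finiteDimensional 𝓘(ℝ, E)
  obtain ⟨δ, hs, hs', hδ⟩ := hX.dilation r hr
  let e : G ≃ₜ* G :=
    { δ with
      continuous_toFun := hs.continuous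
      continuous_invFun := hs'.continuous }
  let m : G ≃ᵐ G := e.toHomeomorph.toMeasurableEquiv
  obtain ⟨c, hc, hm⟩ := exists_map_eq_smul μ e
  obtain ⟨k, U, hk, hU, hU'⟩ := exists_unitary m hc hm
  have hm' : μ.map m.symm = c⁻¹ • μ := by
    have h1 : μ = c • μ.map m.symm := by
      rw [← Measure.map_smul, ← hm]
      exact (m.map_symm_map).symm
    conv_rhs => rw [h1]
    rw [smul_smul, inv_mul_cancel₀ hc.ne', one_smul]
  have q : Measure.QuasiMeasurePreserving m μ μ :=
    ⟨m.measurable, by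
      change μ.map e ≪ μ
      rw [hm]; exact Measure.smul_absolutelyContinuous⟩
  have q' : Measure.QuasiMeasurePreserving m.symm μ μ :=
    ⟨m.symm.measurable, by rw [hm']; exact Measure.smul_absolutelyContinuous⟩
  have hδ' : ∀ (j : Fin n) (f : G → ℂ) (x : G), ContMDiff 𝓘(ℝ, E) 𝓘(ℝ, ℂ) ∞ f →
      leftDeriv (X j) (f ∘ δ.symm) x = (r⁻¹ : ℝ) * leftDeriv (X j) f (δ.symm x) := by
    intro j f x hf
    have h1 := hδ j (f ∘ δ.symm) (δ.symm x) (hf.comp hs')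
    have h2 : (f ∘ δ.symm) ∘ δ = f := by ext; simp
    rw [h2, MulEquiv.apply_symm_apply] at h1
    rw [h1, ← mul_assoc, ← Complex.ofReal_mul, inv_mul_cancel₀ hr.ne', Complex.ofReal_one, one_mul]
  refine ⟨ENNReal.ofReal k * c, U, ?_, ?_, fun u => ?_, fun x y h => ?_, fun x y h => ?_⟩
  · simp [hk, hc.ne']
  · exact ENNReal.mul_ne_top ENNReal.ofReal_ne_top ENNReal.coe_ne_top
  · have h1 : (fun x => (k : ℂ) * u (m x)) = (k : ℂ) • fun x => u (m x) := rfl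
    rw [eLpNorm_congr_ae (hU u), h1, eLpNorm_const_smul, eLpNorm_comp_equiv m hm ENNReal.one_ne_top,
      ← ofReal_norm, Complex.norm_real, Real.norm_of_nonneg hk.le]
    simp [mul_assoc]
  · exact closedGraph_stable (U : Lp ℂ 2 μ →L[ℂ] Lp ℂ 2 μ) _
      (sublaplacianGraph_stable (δ := δ) e.toHomeomorph.isClosedEmbedding q hδ hs k hU) h
  · have := closedGraph_stable (U.symm : Lp ℂ 2 μ →L[ℂ] Lp ℂ 2 μ) _
      (sublaplacianGraph_stable (δ := δ.symm) e.symm.toHomeomorph.isClosedEmbedding q' hδ' hs'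
        ((k⁻¹ : ℝ) : ℂ) hU') h
    rwa [inv_pow] at this

/-- Dilation invariance of the estimates on `L¹`. -/
lemma IsMultiplier.dilate_one (hX : IsStratified X) {r : ℝ} (hr : 0 < r) {F : ℝ → ℂ}
    {B : Lp ℂ 2 μ →L[ℂ] Lp ℂ 2 μ} (h : IsMultiplier (sublaplacianGraph μ X) F B)
    (hF : Continuous F) (hc : Tendsto F atTop (𝓝 (F 0))) {M : ℝ≥0∞}
    (hM : ∀ u, eLpNorm (B u) 1 μ ≤ M * eLpNorm u 1 μ) :
    ∃ B' : Lp ℂ 2 μ →L[ℂ] Lp ℂ 2 μ,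
      IsMultiplier (sublaplacianGraph μ X) (fun l => F (r * l)) B' ∧
      ∀ u, eLpNorm (B' u) 1 μ ≤ M * eLpNorm u 1 μ := by
  obtain ⟨c, U, hc0, hct, hU, h1, h2⟩ := exists_dilation_unitary (μ := μ) hX hr
  refine ⟨_, h.dilate hr U h1 h2 hF hc, fun u => ?_⟩
  rw [LinearIsometryEquiv.conjStarAlgEquiv_apply_apply, LinearIsometryEquiv.symm_symm,
    ← ENNReal.mul_le_mul_iff_right hc0 hct, ← hU, LinearIsometryEquiv.apply_symm_apply]
  refine (hM (U u)).trans (le_of_eq ?_)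
  rw [hU]
  ring

end Group

end OscMult

namespace OscMult

/-! ### Dyadic decomposition of the multiplier -/

section Cutoffs

/-- A smooth function equal to `1` on `(-∞, 1]` and to `0` on `[2, ∞)`. -/
noncomputable def stepDown (l : ℝ) : ℂ := (Real.smoothTransition (2 - l) : ℝ)

lemma contDiff_stepDown : ContDiff ℝ ∞ stepDown :=
  Complex.ofRealCLM.contDiff.comp
    (Real.smoothTransition.contDiff.comp (contDiff_const.sub contDiff_id))

lemma stepDown_eq_one {l : ℝ} (hl : l ≤ 1) : stepDown l = 1 := by
  rw [stepDown, Real.smoothTransition.one_of_one_le (by linarith), Complex.ofReal_one]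

lemma stepDown_eq_zero {l : ℝ} (hl : 2 ≤ l) : stepDown l = 0 := by
  rw [stepDown, Real.smoothTransition.zero_of_nonpos (by linarith), Complex.ofReal_zero]

lemma norm_one_sub_stepDown_le (l : ℝ) : ‖1 - stepDown l‖ ≤ 1 := by
  rw [stepDown, ← Complex.ofReal_one, ← Complex.ofReal_sub, Complex.norm_real, Real.norm_eq_abs,
    abs_le]
  have h0 := Real.smoothTransition.nonneg (2 - l)
  have h1 := Real.smoothTransition.le_one (2 - l)
  constructor <;> linarith

/-- A dyadic bump. -/
noncomputable def dyadicBump (l : ℝ) : ℂ := stepDown (l / 2) - stepDown l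

lemma isBump_of_eq_zero {ψ : ℝ → ℂ} (h : ContDiff ℝ ∞ ψ) {a b : ℝ} (ha : 0 < a)
    (h0 : ∀ l ≤ a, ψ l = 0) (h1 : ∀ l, b ≤ l → ψ l = 0) : IsBump ψ := by
  have hs : Function.support ψ ⊆ Set.Icc a b := fun l hl =>
    ⟨le_of_not_ge fun h => hl (h0 l h), le_of_not_ge fun h => hl (h1 l h)⟩
  have ht : tsupport ψ ⊆ Set.Icc a b := closure_minimal hs isClosed_Icc
  exact ⟨h, HasCompactSupport.of_support_subset_isCompact isCompact_Icc hs,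
    fun l hl => ha.trans_le (ht hl).1⟩

lemma isBump_dyadicBump : IsBump dyadicBump := by
  refine isBump_of_eq_zero (a := 1) (b := 4) ?_ one_pos (fun l hl => ?_) fun l hl => ?_
  · exact (contDiff_stepDown.comp (contDiff_id.div_const 2)).sub contDiff_stepDown
  · rw [dyadicBump, stepDown_eq_one (by linarith), stepDown_eq_one hl, sub_self]
  · rw [dyadicBump, stepDown_eq_zero (by linarith), stepDown_eq_zero (by linarith), sub_self]

lemma IsBump.zero {ψ : ℝ → ℂ} (h : IsBump ψ) : ψ 0 = 0 :=
  image_eq_zero_of_notMem_tsupport fun h0 => lt_irrefl (0 : ℝ) (h.pos h0)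

lemma IsBump.tendsto {ψ : ℝ → ℂ} (h : IsBump ψ) : Tendsto ψ atTop (𝓝 (ψ 0)) := by
  rw [h.zero]
  exact h.compact.is_zero_at_infty.mono_left atTop_le_cocompact

lemma IsBump.continuous {ψ : ℝ → ℂ} (h : IsBump ψ) : Continuous ψ := h.contDiff.continuous

lemma IsBump.exists_bound {ψ : ℝ → ℂ} (h : IsBump ψ) : ∃ c : ℝ, 0 < c ∧ ∀ l, ‖ψ l‖ ≤ c := by
  obtain ⟨C, hC⟩ := h.continuous.bounded_above_of_compact_support h.compact
  have : 0 ≤ C := (norm_nonneg _).trans (hC 0)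
  exact ⟨C + 1, by linarith, fun l => (hC l).trans (by linarith)⟩

/-- The oscillating multiplier `e^{i σ l^θ} l^{-θβ/2} χ(l)`. -/
noncomputable def genMult (χ : ℝ → ℂ) (θ β σ l : ℝ) : ℂ :=
  osc θ σ l * (((l ^ (-(θ * β / 2)) : ℝ) : ℂ) * χ l)

/-- The conditions on the cutoff at low frequencies. -/
structure IsHighPass (χ : ℝ → ℂ) : Prop where
  contDiff : ContDiff ℝ ∞ χ
  zero : ∀ l ≤ 1, χ l = 0
  one : ∀ᶠ l in atTop, χ l = 1

lemma IsHighPass.conj {χ : ℝ → ℂ} (h : IsHighPass χ) :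
    IsHighPass fun l => starRingEnd ℂ (χ l) :=
  ⟨Complex.conjCLE.contDiff.comp h.contDiff, fun l hl => by rw [h.zero l hl, map_zero],
    h.one.mono fun l hl => by rw [hl, map_one]⟩

lemma conj_osc (θ σ l : ℝ) : starRingEnd ℂ (osc θ σ l) = osc θ (-σ) l := by
  rw [osc, osc, ← Complex.exp_conj]
  congr 1
  simp

lemma conj_genMult (χ : ℝ → ℂ) (θ β σ l : ℝ) :
    starRingEnd ℂ (genMult χ θ β σ l) = genMult (fun l => starRingEnd ℂ (χ l)) θ β (-σ) l := by
  rw [genMult, genMult, map_mul, map_mul, conj_osc, Complex.conj_ofReal]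

lemma genMult_eq_oscMultiplier (χ : ℝ → ℂ) (θ β : ℝ) {l : ℝ} (hl : 0 ≤ l) :
    genMult χ θ β 1 l = oscMultiplier χ θ β l := by
  rw [genMult, oscMultiplier, osc, Real.rpow_neg hl, one_mul, Complex.ofReal_inv]
  ring

lemma IsHighPass.continuous_genMult {χ : ℝ → ℂ} (h : IsHighPass χ) (θ β σ : ℝ) :
    Continuous (genMult χ θ β σ) := by
  rw [continuous_iff_continuousAt]
  intro l
  rcases lt_or_ge 0 l with hl | hl
  · exact (contDiffAt_osc θ σ hl).continuousAt.mul
      ((contDiffAt_rpow_ofReal _ hl).continuousAt.mul h.contDiff.continuous.continuousAt)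
  · refine (continuousAt_const (y := (0:ℂ))).congr ?_
    filter_upwards [Iio_mem_nhds (lt_of_le_of_lt hl one_pos)] with s hs
    rw [genMult, h.zero s (Set.mem_Iio.1 hs).le, mul_zero, mul_zero]

lemma IsHighPass.genMult_zero {χ : ℝ → ℂ} (h : IsHighPass χ) (θ β σ : ℝ) :
    genMult χ θ β σ 0 = 0 := by
  rw [genMult, h.zero 0 zero_le_one, mul_zero, mul_zero]

lemma IsHighPass.tendsto_genMult {χ : ℝ → ℂ} (h : IsHighPass χ) {θ β : ℝ} (hθβ : 0 < θ * β)
    (σ : ℝ) : Tendsto (genMult χ θ β σ) atTop (𝓝 0) := by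
  rw [tendsto_zero_iff_norm_tendsto_zero]
  refine (tendsto_rpow_neg_atTop (y := θ * β / 2) (by linarith)).congr' ?_
  filter_upwards [h.one, eventually_ge_atTop 0] with l hl h0
  rw [genMult, norm_mul, norm_osc, hl, one_mul, mul_one, Complex.norm_real,
    Real.norm_of_nonneg (Real.rpow_nonneg h0 _)]

lemma genMult_theta_zero (χ : ℝ → ℂ) (β σ l : ℝ) :
    genMult χ 0 β σ l = Complex.exp (Complex.I * σ) * χ l := by
  simp [genMult, osc]

/-- The truncation of the multiplier to frequencies at most `2 a`. -/
noncomputable def truncMult (χ : ℝ → ℂ) (θ β σ a l : ℝ) : ℂ :=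
  osc θ σ l * (((l ^ (-(θ * β / 2)) : ℝ) : ℂ) * (χ l * stepDown (a⁻¹ * l)))

lemma truncMult_eq (χ : ℝ → ℂ) (θ β σ a l : ℝ) :
    truncMult χ θ β σ a l = genMult χ θ β σ l * stepDown (a⁻¹ * l) := by
  rw [truncMult, genMult]
  ring

lemma IsHighPass.isBump_mul_stepDown {χ : ℝ → ℂ} (h : IsHighPass χ) {a : ℝ} (ha : 0 < a) :
    IsBump fun l => χ l * stepDown (a⁻¹ * l) := by
  refine isBump_of_eq_zero (a := 1) (b := 2 * a) ?_ one_pos (fun l hl => ?_) fun l hl => ?_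
  · exact h.contDiff.mul (contDiff_stepDown.comp (contDiff_const.mul contDiff_id))
  · rw [h.zero l hl, zero_mul]
  · rw [stepDown_eq_zero, mul_zero]
    rw [inv_mul_eq_div, le_div_iff₀ ha]
    exact hl

lemma IsHighPass.isBump_truncMult {χ : ℝ → ℂ} (h : IsHighPass χ) (θ β σ : ℝ) {a : ℝ} (ha : 0 < a) :
    IsBump (truncMult χ θ β σ a) := ((h.isBump_mul_stepDown ha).rpow _).osc θ σ

/-- The remainder after truncation is small. -/
lemma norm_genMult_sub_truncMult_le {χ : ℝ → ℂ} {θ β a : ℝ} (ha : 0 < a) (hθβ : 0 ≤ θ * β)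
    (h1 : ∀ l, a ≤ l → χ l = 1) (σ l : ℝ) :
    ‖genMult χ θ β σ l - truncMult χ θ β σ a l‖ ≤ a ^ (-(θ * β / 2)) := by
  have e : genMult χ θ β σ l - truncMult χ θ β σ a l =
      genMult χ θ β σ l * (1 - stepDown (a⁻¹ * l)) := by
    rw [truncMult_eq]
    ring
  rw [e]
  rcases le_or_gt l a with hl | hl
  · rw [stepDown_eq_one, sub_self, mul_zero, norm_zero]
    · positivity
    · rw [inv_mul_eq_div, div_le_one ha]
      exact hl
  · have hl0 : 0 < l := ha.trans hl
    calc _ ≤ ‖genMult χ θ β σ l‖ * 1 := by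
          rw [norm_mul]
          gcongr
          exact norm_one_sub_stepDown_le _
      _ = l ^ (-(θ * β / 2)) := by
          rw [genMult, norm_mul, norm_osc, h1 l hl.le, one_mul, mul_one, mul_one, Complex.norm_real,
            Real.norm_of_nonneg (Real.rpow_nonneg hl0.le _)]
      _ ≤ _ := Real.rpow_le_rpow_of_nonpos ha hl.le (by linarith)

/-- The dyadic pieces of the multiplier are dilated bumps. -/
lemma truncMult_sub_truncMult {χ : ℝ → ℂ} {θ β a : ℝ} (ha : 0 < a)
    (h1 : ∀ l, a ≤ l → χ l = 1) (σ : ℝ) {l : ℝ} (hl : 0 ≤ l) :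
    truncMult χ θ β σ (2 * a) l - truncMult χ θ β σ a l =
      (((a ^ θ) ^ (-(β / 2)) : ℝ) : ℂ) * (osc θ (σ * a ^ θ) (a⁻¹ * l) *
        ((((a⁻¹ * l) ^ (-(θ * β / 2)) : ℝ) : ℂ) * dyadicBump (a⁻¹ * l))) := by
  have e : truncMult χ θ β σ (2 * a) l - truncMult χ θ β σ a l =
      genMult χ θ β σ l * dyadicBump (a⁻¹ * l) := by
    rw [truncMult_eq, truncMult_eq, dyadicBump, mul_inv, ← mul_sub]
    congr 3
    ring
  rw [e]
  -- Below `a` the dyadic bump vanishes, so the value of `χ` is needed only where it is 1.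
  rcases lt_or_ge l a with h | h
  · have h2 : dyadicBump (a⁻¹ * l) = 0 := by
      have : a⁻¹ * l ≤ 1 := by
        rw [inv_mul_eq_div, div_le_one ha]
        exact h.le
      rw [dyadicBump, stepDown_eq_one this, stepDown_eq_one (by linarith), sub_self]
    rw [h2]
    simp
  · have ea : σ * a ^ θ * (a⁻¹ * l) ^ θ = σ * l ^ θ := by
      rw [Real.mul_rpow (by positivity) hl, Real.inv_rpow ha.le]
      have := (Real.rpow_pos_of_pos ha θ).ne'
      field_simp
    have eb : (a ^ θ) ^ (-(β / 2)) * (a⁻¹ * l) ^ (-(θ * β / 2)) = l ^ (-(θ * β / 2)) := by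
      rw [Real.mul_rpow (by positivity) hl, Real.inv_rpow ha.le, ← Real.rpow_mul ha.le,
        show θ * -(β / 2) = -(θ * β / 2) by ring]
      have := (Real.rpow_pos_of_pos ha (-(θ * β / 2))).ne'
      field_simp
    rw [genMult, h1 l h, osc, osc, ea, ← eb, Complex.ofReal_mul ((a ^ θ) ^ (-(β / 2)))]
    ring

end Cutoffs

end OscMult

namespace OscMult

/-! ### Summing geometrically decaying pieces -/

section Summation

variable {Y : Type*} [MeasurableSpace Y] {μ : Measure Y}

/-- The triangle inequality on the telescoping sum bounds all `S N` uniformly on `Lᵖ`. The limit is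
taken only in the `L²` operator norm, and the `Lᵖ` bound survives it by Fatou. -/
lemma eLpNorm_le_of_geometric {p : ℝ≥0∞} (hp : 1 ≤ p) {S : ℕ → Lp ℂ 2 μ →L[ℂ] Lp ℂ 2 μ}
    {B : Lp ℂ 2 μ →L[ℂ] Lp ℂ 2 μ} (hS : Tendsto S atTop (𝓝 B)) {A K q : ℝ} (hA : 0 ≤ A)
    (hK : 0 ≤ K) (hq0 : 0 ≤ q) (hq1 : q < 1) (u : Lp ℂ 2 μ)
    (h0 : eLpNorm (S 0 u) p μ ≤ ENNReal.ofReal A * eLpNorm u p μ)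
    (h1 : ∀ N, eLpNorm ((S (N + 1) - S N) u) p μ ≤ ENNReal.ofReal (K * q ^ N) * eLpNorm u p μ) :
    eLpNorm (B u) p μ ≤ ENNReal.ofReal (A + K * (1 - q)⁻¹) * eLpNorm u p μ := by
  have hsum : ∀ N, eLpNorm (S N u) p μ ≤
      ENNReal.ofReal (A + K * ∑ j ∈ Finset.range N, q ^ j) * eLpNorm u p μ := by
    intro N
    induction N with
    | zero => simpa using h0
    | succ N ih =>
      have e : S (N + 1) u = S N u + (S (N + 1) - S N) u := by
        rw [sub_apply, add_sub_cancel]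
      have h2 : eLpNorm (S (N + 1) u) p μ ≤
          eLpNorm (S N u) p μ + eLpNorm ((S (N + 1) - S N) u) p μ := by
        rw [e, eLpNorm_congr_ae (Lp.coeFn_add _ _)]
        exact eLpNorm_add_le (Lp.aestronglyMeasurable _) (Lp.aestronglyMeasurable _) hp
      refine h2.trans ((add_le_add ih (h1 N)).trans (le_of_eq ?_))
      have : 0 ≤ ∑ j ∈ Finset.range N, q ^ j := Finset.sum_nonneg fun j _ => pow_nonneg hq0 j
      rw [← add_mul, ← ENNReal.ofReal_add (by positivity) (by positivity), Finset.sum_range_succ]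
      congr 2
      ring
  refine eLpNorm_le_of_tendsto (v := fun N => S N u)
    (((ContinuousLinearMap.apply ℂ (Lp ℂ 2 μ) u).continuous.tendsto B).comp hS) fun N => ?_
  refine (hsum N).trans ?_
  gcongr
  rw [← tsum_geometric_of_lt_one hq0 hq1]
  exact (summable_geometric_of_lt_one hq0 hq1).sum_le_tsum _ fun j _ => pow_nonneg hq0 j

end Summation

/-! ### Bounded multipliers and consequences of the `L¹` estimate -/

section Bounded

variable {E : Type*} [NormedAddCommGroup E] [NormedSpace ℝ E]
  {G : Type*} [TopologicalSpace G] [ChartedSpace E G] [Group G]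
  [MeasurableSpace G] {μ : Measure G} {n : ℕ} {X : Fin n → GroupLieAlgebra 𝓘(ℝ, E) G}

variable (μ X) in
/-- `F(√L)` is a bounded operator on `L²` and on `Lᵖ`. -/
def BoundedMultiplier (p : ℝ≥0∞) (F : ℝ → ℂ) : Prop :=
  ∃ B : Lp ℂ 2 μ →L[ℂ] Lp ℂ 2 μ, IsMultiplier (sublaplacianGraph μ X) F B ∧
    ∃ C : ℝ≥0∞, C ≠ ⊤ ∧ ∀ u, eLpNorm (B u) p μ ≤ C * eLpNorm u p μ

lemma BoundedMultiplier.multiplierNorm_lt_top {p : ℝ≥0∞} {F : ℝ → ℂ}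
    (h : BoundedMultiplier μ X p F) : multiplierNorm μ X p F < ⊤ := by
  obtain ⟨B, hB, C, hC, h⟩ := h
  exact (sInf_le ⟨B, hB, h⟩ : multiplierNorm μ X p F ≤ C).trans_lt (lt_top_iff_ne_top.2 hC)

lemma BoundedMultiplier.congr {p : ℝ≥0∞} {F F' : ℝ → ℂ} (h : BoundedMultiplier μ X p F)
    (hF : ∀ l, 0 ≤ l → F l = F' l) : BoundedMultiplier μ X p F' :=
  let ⟨B, hB, hC⟩ := h
  ⟨B, hB.congr hF, hC⟩

/-- The adjoint of `F(√L)` is the multiplier with the conjugate function. -/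
lemma BoundedMultiplier.of_conj {p q : ℝ} (hpq : p.HolderConjugate q) {F : ℝ → ℂ}
    (h : BoundedMultiplier μ X (ENNReal.ofReal p) fun l => starRingEnd ℂ (F l)) :
    BoundedMultiplier μ X (ENNReal.ofReal q) F := by
  obtain ⟨B, hB, C, hC, h⟩ := h
  refine ⟨B.adjoint, ?_, C, hC, fun u => eLpNorm_le_of_adjoint _ hpq ?_ u⟩
  · have := hB.adjoint
    simpa only [Complex.conj_conj] using this
  · rwa [ContinuousLinearMap.adjoint_adjoint]

lemma boundedMultiplier_two {F : ℝ → ℂ} {c : ℂ} (hF : Continuous F) (hc : Tendsto F atTop (𝓝 c)) :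
    BoundedMultiplier μ X 2 F := by
  obtain ⟨B, hB⟩ := exists_isMultiplier (D := sublaplacianGraph μ X) hF hc
  refine ⟨B, hB, ENNReal.ofReal ‖B‖, ENNReal.ofReal_ne_top, fun u => ?_⟩
  rw [← Lp.enorm_def, ← Lp.enorm_def, ← ofReal_norm, ← ofReal_norm,
    ← ENNReal.ofReal_mul (norm_nonneg _)]
  exact ENNReal.ofReal_le_ofReal (B.le_opNorm u)

/-- The defining property of the threshold, for smooth functions of compact support. -/
lemma HasL1Estimate.exists_const {s : ℝ≥0} (h : HasL1Estimate μ X s) {K : Set ℝ}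
    (hK : IsCompact K) : ∃ C : ℝ, 0 ≤ C ∧ ∀ (F : ℝ → ℂ) (M : ℝ), Measurable F → tsupport F ⊆ K →
      0 ≤ M → sobolevNorm s F ≤ ENNReal.ofReal M → ∀ M' : ℝ, C * M < M' →
      ∃ B : Lp ℂ 2 μ →L[ℂ] Lp ℂ 2 μ, IsMultiplier (sublaplacianGraph μ X) F B ∧
        ∀ u, eLpNorm (B u) 1 μ ≤ ENNReal.ofReal M' * eLpNorm u 1 μ := by
  obtain ⟨C, hC⟩ := h K hK
  refine ⟨C, C.coe_nonneg, fun F M hF hFK hM0 hM M' hM' => ?_⟩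
  have h1 : multiplierNorm μ X 1 F < ENNReal.ofReal M' := by
    calc multiplierNorm μ X 1 F ≤ C * sobolevNorm s F := hC F hF hFK
      _ ≤ C * ENNReal.ofReal M := by gcongr
      _ = ENNReal.ofReal (C * M) := by
          rw [ENNReal.ofReal_mul C.coe_nonneg, ENNReal.ofReal_coe_nnreal]
      _ < ENNReal.ofReal M' := by
          rw [ENNReal.ofReal_lt_ofReal_iff_of_nonneg (by positivity)]
          exact hM'
  obtain ⟨D, ⟨B, hB, hD⟩, hDM⟩ := sInf_lt_iff.1 h1
  exact ⟨B, hB, fun u => (hD u).trans (by gcongr)⟩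

lemma HasL1Estimate.exists_osc {s : ℝ≥0} (h : HasL1Estimate μ X s) (θ : ℝ) {ψ : ℝ → ℂ}
    (hψ : IsBump ψ) : ∃ C : ℝ, 0 < C ∧ ∀ R : ℝ, 1 ≤ |R| → ∃ B : Lp ℂ 2 μ →L[ℂ] Lp ℂ 2 μ,
      IsMultiplier (sublaplacianGraph μ X) (fun l => osc θ R l * ψ l) B ∧
        ∀ u, eLpNorm (B u) 1 μ ≤ ENNReal.ofReal (C * |R| ^ (s : ℝ)) * eLpNorm u 1 μ := by
  obtain ⟨C₁, hC₁, H₁⟩ := h.exists_const (K := tsupport ψ) hψ.compact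
  obtain ⟨C₂, hC₂, H₂⟩ := sobolevNorm_osc_le θ s hψ
  -- The `+ 1` gives the strict inequality required because the multiplier norm is an infimum.
  refine ⟨C₁ * C₂ + 1, by positivity, fun R hR => ?_⟩
  have hR0 : 0 < |R| := by linarith
  refine H₁ _ (C₂ * |R| ^ (s : ℝ)) (hψ.osc θ R).continuous.measurable tsupport_mul_subset_right
    (by positivity) (H₂ R hR) _ ?_
  have := Real.rpow_pos_of_pos hR0 s
  nlinarith

variable [SigmaFinite μ]

lemma boundedMultiplier_of_one {p : ℝ} (hp1 : 1 < p) (hp2 : p < 2) {M : ℝ} (hM : 0 < M)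
    {B : Lp ℂ 2 μ →L[ℂ] Lp ℂ 2 μ}
    (h : ∀ u, eLpNorm (B u) 1 μ ≤ ENNReal.ofReal M * eLpNorm u 1 μ) :
    ∃ A : ℝ, 0 ≤ A ∧ ∀ u, eLpNorm (B u) (ENNReal.ofReal p) μ ≤
      ENNReal.ofReal A * eLpNorm u (ENNReal.ofReal p) μ := by
  have hI := interpConst_pos hp1 hp2
  exact ⟨_, by positivity, eLpNorm_interpolate B hp1 hp2 hM
    (by positivity : 0 < ‖B‖ + 1) h (by linarith)⟩

/-- Without oscillation the multiplier differs from a constant by a smooth function of compact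
support. -/
lemma boundedMultiplier_theta_zero {s : ℝ≥0} (h : HasL1Estimate μ X s) {p : ℝ} (hp1 : 1 < p)
    (hp2 : p < 2) {χ : ℝ → ℂ} (hχ : IsHighPass χ) (β σ : ℝ) :
    BoundedMultiplier μ X (ENNReal.ofReal p) (genMult χ 0 β σ) := by
  obtain ⟨b, hb⟩ := eventually_atTop.1 hχ.one
  -- On the negative axis `1 - χ` is 1. The second factor cuts it off there, where the spectral
  -- measure has no mass, so that `F` has compact support and still equals `1 - χ` on `[0, ∞)`.
  let F : ℝ → ℂ := fun l => (1 - χ l) * stepDown (-l)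
  have hF : ContDiff ℝ ∞ F :=
    (contDiff_const.sub hχ.contDiff).mul (contDiff_stepDown.comp contDiff_neg)
  have hFs : Function.support F ⊆ Set.Icc (-2) b := by
    intro l hl
    constructor
    · by_contra! h1
      exact hl (by simp only [F]; rw [stepDown_eq_zero (by linarith), mul_zero])
    · by_contra! h1
      exact hl (by simp only [F]; rw [hb l h1.le, sub_self, zero_mul])
  have hFc : HasCompactSupport F := HasCompactSupport.of_support_subset_isCompact isCompact_Icc hFs
  obtain ⟨k, hk⟩ := exists_nat_ge (s : ℝ)
  have hfin : sobolevNorm s F ≠ ⊤ := by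
    refine ne_top_of_le_ne_top ?_ (sobolevNorm_le hk le_rfl hF hFc)
    have m1 : MemLp F 2 volume := hF.continuous.memLp_of_hasCompactSupport hFc
    have m2 : MemLp (iteratedDeriv k F) 2 volume :=
      (contDiff_iteratedDeriv hF k).continuous.memLp_of_hasCompactSupport
        (hFc.of_isClosed_subset isClosed_closure (tsupport_iteratedDeriv_subset F k))
    exact ENNReal.mul_ne_top ENNReal.ofReal_ne_top (ENNReal.add_ne_top.2
      ⟨m1.eLpNorm_ne_top, ENNReal.mul_ne_top ENNReal.ofReal_ne_top m2.eLpNorm_ne_top⟩)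
  obtain ⟨C, hC, H⟩ := h.exists_const hFc
  obtain ⟨B, hB, hB1⟩ := H F (sobolevNorm s F).toReal hF.continuous.measurable subset_rfl
    ENNReal.toReal_nonneg (ENNReal.ofReal_toReal hfin).ge (C * (sobolevNorm s F).toReal + 1)
    (by linarith)
  have hone : ∀ u : Lp ℂ 2 μ, eLpNorm ((Complex.exp (Complex.I * σ) •
      ((1 : Lp ℂ 2 μ →L[ℂ] Lp ℂ 2 μ) + (-1 : ℂ) • B)) u) 1 μ ≤
      ENNReal.ofReal (1 + (C * (sobolevNorm s F).toReal + 1)) * eLpNorm u 1 μ := by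
    intro u
    have e : (Complex.exp (Complex.I * σ) •
        ((1 : Lp ℂ 2 μ →L[ℂ] Lp ℂ 2 μ) + (-1 : ℂ) • B)) u = Complex.exp (Complex.I * σ) •
          (u - B u) := by
      rw [smul_apply, add_apply, smul_apply, neg_smul, one_smul, ← sub_eq_add_neg]
      rfl
    rw [e, eLpNorm_congr_ae (Lp.coeFn_smul _ _), eLpNorm_const_smul,
      eLpNorm_congr_ae (Lp.coeFn_sub _ _)]
    have e2 : ‖Complex.exp (Complex.I * σ)‖ₑ = 1 := by
      rw [← ofReal_norm, mul_comm, Complex.norm_exp_ofReal_mul_I, ENNReal.ofReal_one]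
    rw [e2, one_mul, ENNReal.ofReal_add zero_le_one (by positivity), ENNReal.ofReal_one, add_mul,
      one_mul]
    exact (eLpNorm_sub_le (Lp.aestronglyMeasurable _) (Lp.aestronglyMeasurable _) le_rfl).trans
      (by gcongr; exact hB1 u)
  obtain ⟨A, hA, HA⟩ := boundedMultiplier_of_one hp1 hp2 (by positivity) hone
  have hm := (isMultiplier_one.add (hB.const_smul (-1))).const_smul (Complex.exp (Complex.I * σ))
  refine ⟨_, hm.congr fun l hl => ?_, ENNReal.ofReal A, ENNReal.ofReal_ne_top, HA⟩
  rw [genMult_theta_zero]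
  simp only [F]
  rw [stepDown_eq_one (by linarith)]
  ring

end Bounded

/-! ### The case `1 < p < 2` -/

section Main

variable {E : Type*} [NormedAddCommGroup E] [NormedSpace ℝ E] [FiniteDimensional ℝ E]
  {G : Type*} [TopologicalSpace G] [T2Space G] [SecondCountableTopology G]
  [ChartedSpace E G] [Group G] [LieGroup 𝓘(ℝ, E) ∞ G]
  [MeasurableSpace G] [BorelSpace G] {μ : Measure G} [μ.IsMulRightInvariant]
  [IsFiniteMeasureOnCompacts μ] [μ.IsOpenPosMeasure] [SigmaFinite μ]
  {n : ℕ} {X : Fin n → GroupLieAlgebra 𝓘(ℝ, E) G}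

/-- The estimate for the dyadic pieces. -/
lemma exists_dyadic_estimate (hX : IsStratified X) {s : ℝ≥0} (h : HasL1Estimate μ X s)
    {θ β p : ℝ} (hθ : 0 < θ) (hp1 : 1 < p) (hp2 : p < 2) {σ : ℝ} (hσ : |σ| = 1)
    {χ : ℝ → ℂ} {b : ℝ} (h1 : ∀ l, b ≤ l → χ l = 1) :
    ∃ K : ℝ, 0 ≤ K ∧ ∀ a, 1 ≤ a → b ≤ a → ∃ B : Lp ℂ 2 μ →L[ℂ] Lp ℂ 2 μ,
      IsMultiplier (sublaplacianGraph μ X)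
        (fun l => truncMult χ θ β σ (2 * a) l - truncMult χ θ β σ a l) B ∧
      ∀ u, eLpNorm (B u) (ENNReal.ofReal p) μ ≤
        ENNReal.ofReal (K * (a ^ θ) ^ (s * (2 / p - 1) - β / 2)) *
          eLpNorm u (ENNReal.ofReal p) μ := by
  have hψ : IsBump fun l => ((l ^ (-(θ * β / 2)) : ℝ) : ℂ) * dyadicBump l :=
    isBump_dyadicBump.rpow _
  set ψ : ℝ → ℂ := fun l => ((l ^ (-(θ * β / 2)) : ℝ) : ℂ) * dyadicBump l with hψdef
  obtain ⟨C, hC, H⟩ := h.exists_osc θ hψ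
  obtain ⟨c, hc, hcψ⟩ := hψ.exists_bound
  have hI := interpConst_pos hp1 hp2
  refine ⟨interpConst p ^ (1 / p) * (C ^ (2 / p - 1) * (2 * c) ^ (2 - 2 / p)), by positivity,
    fun a ha hba => ?_⟩
  have ha0 : 0 < a := by linarith
  set R := a ^ θ with hR
  have hR1 : 1 ≤ R := Real.one_le_rpow ha hθ.le
  have hR0 : 0 < R := by linarith
  have hσR : |σ * R| = R := by rw [abs_mul, hσ, one_mul, abs_of_pos hR0]
  obtain ⟨B₀, hB₀, hB₀1⟩ := H (σ * R) (by rw [hσR]; exact hR1)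
  have hosc := hψ.osc θ (σ * R)
  -- The bound at unit frequency depends on `a` only through `R`, and the dilation to frequency `a`
  -- preserves it.
  obtain ⟨B₁, hB₁, hB₁1⟩ := hB₀.dilate_one hX (inv_pos.2 ha0) hosc.continuous hosc.tendsto hB₀1
  have hB₁2 : ‖B₁‖ ≤ 2 * c := by
    refine hB₁.norm_le (hosc.continuous.comp (continuous_const.mul continuous_id)) ?_ fun l => ?_
    · rw [mul_zero]
      exact hosc.tendsto.comp (tendsto_id.const_mul_atTop (inv_pos.2 ha0))
    · rw [norm_mul, norm_osc, one_mul]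
      exact hcψ _
  have hRβ : 0 < R ^ (-(β / 2)) := Real.rpow_pos_of_pos hR0 _
  have hn : ‖((R ^ (-(β / 2)) : ℝ) : ℂ)‖ = R ^ (-(β / 2)) := by
    rw [Complex.norm_real, Real.norm_of_nonneg hRβ.le]
  have hRs : 0 < R ^ (s : ℝ) := Real.rpow_pos_of_pos hR0 _
  refine ⟨((R ^ (-(β / 2)) : ℝ) : ℂ) • B₁, (hB₁.const_smul _).congr fun l hl => ?_, fun u => ?_⟩
  · rw [truncMult_sub_truncMult ha0 (fun l hl => h1 l (hba.trans hl)) σ hl]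
  have key := eLpNorm_interpolate (((R ^ (-(β / 2)) : ℝ) : ℂ) • B₁) hp1 hp2
    (M₁ := R ^ (-(β / 2)) * (C * R ^ (s : ℝ))) (M₂ := R ^ (-(β / 2)) * (2 * c))
    (by positivity) (by positivity) (fun u => ?_) ?_ u
  · refine key.trans (le_of_eq ?_)
    congr 2
    rw [mul_assoc]
    congr 1
    rw [Real.mul_rpow hRβ.le (by positivity), Real.mul_rpow hC.le hRs.le,
      Real.mul_rpow hRβ.le (by positivity), ← Real.rpow_mul hR0.le, ← Real.rpow_mul hR0.le,
      ← Real.rpow_mul hR0.le]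
    -- The interpolation exponents `2/p - 1` and `2 - 2/p` add up to 1, so the common factor
    -- `R^(-β/2)` comes through unchanged.
    have e : R ^ ((s : ℝ) * (2 / p - 1) - β / 2) = R ^ (-(β / 2) * (2 / p - 1)) *
        R ^ ((s : ℝ) * (2 / p - 1)) * R ^ (-(β / 2) * (2 - 2 / p)) := by
      rw [← Real.rpow_add hR0, ← Real.rpow_add hR0]
      congr 1
      ring
    rw [e]
    ring
  · rw [smul_apply, eLpNorm_congr_ae (Lp.coeFn_smul _ _), eLpNorm_const_smul, ← ofReal_norm, hn,
      ENNReal.ofReal_mul hRβ.le, mul_assoc]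
    gcongr
    rw [← hσR]
    exact hB₁1 u
  · rw [norm_smul, hn]
    gcongr

/-- For `θ > 0` the piece at frequency `2^(J+N)` has `Lᵖ` norm at most a constant times
`2^((J+N)θe)`, with `e = s(2/p-1) - β/2 < 0`. -/
lemma boundedMultiplier_of_lt_two (hX : IsStratified X) {s : ℝ≥0} (h : HasL1Estimate μ X s)
    {θ β p : ℝ} (hθ : 0 ≤ θ) (hβ : 0 < β) (hp1 : 1 < p) (hp2 : p < 2)
    (hs : s * (2 / p - 1) < β / 2) {σ : ℝ} (hσ : |σ| = 1) {χ : ℝ → ℂ} (hχ : IsHighPass χ) :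
    BoundedMultiplier μ X (ENNReal.ofReal p) (genMult χ θ β σ) := by
  rcases hθ.eq_or_lt with rfl | hθ
  · exact boundedMultiplier_theta_zero h hp1 hp2 hχ β σ
  have hθβ : 0 < θ * β := mul_pos hθ hβ
  obtain ⟨b, hb⟩ := eventually_atTop.1 hχ.one
  -- The dyadic pieces start where `χ` is already 1; everything below belongs to the single initial
  -- term.
  obtain ⟨J, hJ⟩ := pow_unbounded_of_one_lt b (one_lt_two (α := ℝ))
  let a : ℕ → ℝ := fun N => 2 ^ (J + N)
  have ha1 : ∀ N, 1 ≤ a N := fun N => one_le_pow₀ one_le_two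
  have ha0 : ∀ N, 0 < a N := fun N => by linarith [ha1 N]
  have hab : ∀ N, b ≤ a N := fun N =>
    hJ.le.trans (pow_le_pow_right₀ one_le_two (Nat.le_add_right J N))
  have hθpow : ∀ (N : ℕ) (x : ℝ), (a N) ^ x = (2 ^ x) ^ J * ((2 : ℝ) ^ x) ^ N := by
    intro N x
    simp only [a]
    rw [← pow_add, ← Real.rpow_natCast, ← Real.rpow_natCast, ← Real.rpow_mul two_pos.le,
      ← Real.rpow_mul two_pos.le, mul_comm]
  obtain ⟨K, hK, HK⟩ := exists_dyadic_estimate (μ := μ) (β := β) hX h hθ hp1 hp2 hσ hb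
  have hbump := fun N => hχ.isBump_truncMult θ β σ (ha0 N)
  let S : ℕ → Lp ℂ 2 μ →L[ℂ] Lp ℂ 2 μ := fun N =>
    fcalc (resolventSq (sublaplacianGraph μ X))
      (pullback (truncMult χ θ β σ (a N)) (truncMult χ θ β σ (a N) 0))
  have hS : ∀ N, IsMultiplier (sublaplacianGraph μ X) (truncMult χ θ β σ (a N)) (S N) := fun N =>
    isMultiplier_pullback (hbump N).continuous (hbump N).tendsto
  have hmc := hχ.continuous_genMult θ β σ
  have hm0 : Tendsto (genMult χ θ β σ) atTop (𝓝 (genMult χ θ β σ 0)) := by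
    rw [hχ.genMult_zero]
    exact hχ.tendsto_genMult hθβ σ
  obtain ⟨B, hB⟩ : ∃ B : Lp ℂ 2 μ →L[ℂ] Lp ℂ 2 μ,
      IsMultiplier (sublaplacianGraph μ X) (genMult χ θ β σ) B := ⟨_, isMultiplier_pullback hmc hm0⟩
  -- The decay of the multiplier makes the truncations converge in the operator norm of `L²`.
  have hdiff : ∀ N, ‖S N - B‖ ≤ 2 * a N ^ (-(θ * β / 2)) := by
    intro N
    have hd := hB.add ((hS N).const_smul (-1))
    have := hd.norm_le (hmc.add (continuous_const.mul (hbump N).continuous))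
      (hm0.add ((hbump N).tendsto.const_mul (-1))) (C := a N ^ (-(θ * β / 2))) fun l => by
        rw [neg_one_mul, ← sub_eq_add_neg]
        exact norm_genMult_sub_truncMult_le (ha0 N) hθβ.le (fun l hl => hb l ((hab N).trans hl)) σ l
    rwa [neg_smul, one_smul, ← sub_eq_add_neg, norm_sub_rev] at this
  have hlim : Tendsto S atTop (𝓝 B) := by
    rw [tendsto_iff_norm_sub_tendsto_zero]
    refine squeeze_zero (fun _ => norm_nonneg _) hdiff ?_
    simp_rw [hθpow]
    have h2 : (2 : ℝ) ^ (-(θ * β / 2)) < 1 :=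
      Real.rpow_lt_one_of_one_lt_of_neg one_lt_two (by linarith)
    have := tendsto_pow_atTop_nhds_zero_of_lt_one (by positivity) h2
    simpa using (this.const_mul (((2 : ℝ) ^ (-(θ * β / 2))) ^ J)).const_mul 2
  -- The initial term is one oscillating bump with parameter `R = σ`, so it needs no dilation.
  obtain ⟨C₀, hC₀, H₀⟩ := h.exists_osc θ ((hχ.isBump_mul_stepDown (ha0 0)).rpow (-(θ * β / 2)))
  obtain ⟨B₀, hB₀, hB₀1⟩ := H₀ σ hσ.ge
  obtain ⟨A, hA, HA⟩ := boundedMultiplier_of_one hp1 hp2 (by rw [hσ]; positivity) hB₀1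
  set e : ℝ := s * (2 / p - 1) - β / 2 with he
  have hq : (2 : ℝ) ^ (θ * e) < 1 :=
    Real.rpow_lt_one_of_one_lt_of_neg one_lt_two (mul_neg_of_pos_of_neg hθ (by linarith))
  refine ⟨B, hB, _, ENNReal.ofReal_ne_top, fun u => eLpNorm_le_of_geometric
    (by simpa using hp1.le) hlim hA (K := K * ((2 : ℝ) ^ (θ * e)) ^ J) (by positivity)
    (by positivity) hq u ?_ fun N => ?_⟩
  · rw [(hS 0).unique hB₀]
    exact HA u
  · obtain ⟨B', hB', hB'p⟩ := HK (a N) (ha1 N) (hab N)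
    have hSd := (hS (N + 1)).add ((hS N).const_smul (-1))
    have hSd' : S (N + 1) - S N = B' := by
      rw [sub_eq_add_neg, ← neg_one_smul ℂ (S N)]
      refine hSd.unique (hB'.congr fun l _ => ?_)
      have : a (N + 1) = 2 * a N := by
        simp only [a]
        ring
      rw [this]
      ring
    rw [hSd']
    refine (hB'p u).trans (le_of_eq ?_)
    rw [← Real.rpow_mul (ha0 N).le, hθpow, mul_assoc]

end Main

end OscMult

namespace OscMult

/-! ### The threshold, the exponent 2 and duality -/

section Final

variable {E : Type*} [NormedAddCommGroup E] [NormedSpace ℝ E] [FiniteDimensional ℝ E]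
    {G : Type*} [TopologicalSpace G] [T2Space G] [SecondCountableTopology G] [ConnectedSpace G]
    [ChartedSpace E G] [Group G] [LieGroup 𝓘(ℝ, E) ∞ G]
    [MeasurableSpace G] [BorelSpace G]
    {μ : Measure G} [μ.IsMulRightInvariant] [IsFiniteMeasureOnCompacts μ] [μ.IsOpenPosMeasure]
    {n : ℕ} {X : Fin n → GroupLieAlgebra 𝓘(ℝ, E) G}

/-- Below the threshold line there is an admissible order of smoothness. -/
lemma exists_hasL1Estimate_of_lt {d β : ℝ} (hd : 0 < d)
    (h : 2 * sPlus μ X * ENNReal.ofReal d < ENNReal.ofReal (β / 2)) :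
    ∃ s : ℝ≥0, HasL1Estimate μ X s ∧ s * (2 * d) < β / 2 := by
  have hd' : (0 : ℝ) < 2 * d := by positivity
  -- Dividing by `2 d > 0` isolates the infimum, and a strict upper bound for an infimum is attained
  -- by some admissible `s`.
  have h' : sPlus μ X < ENNReal.ofReal (β / 2) / ENNReal.ofReal (2 * d) := by
    rw [ENNReal.lt_div_iff_mul_lt (.inl (by simpa using hd)) (.inl ENNReal.ofReal_ne_top),
      ENNReal.ofReal_mul zero_le_two, ENNReal.ofReal_ofNat]
    convert h using 1
    ring
  obtain ⟨s, hs⟩ := iInf_lt_iff.1 h'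
  obtain ⟨hs1, hs2⟩ := iInf_lt_iff.1 hs
  refine ⟨s, hs1, ?_⟩
  rw [ENNReal.lt_div_iff_mul_lt (.inl (by simpa using hd)) (.inl ENNReal.ofReal_ne_top),
    ← ENNReal.ofReal_coe_nnreal, ← ENNReal.ofReal_mul s.coe_nonneg] at hs2
  exact (ENNReal.ofReal_lt_ofReal_iff_of_nonneg (by positivity)).1 hs2

/-- The end points `p = 1, ∞` are excluded for exponents `β` below twice the threshold. -/
lemma not_two_mul_half_lt {s : ℝ≥0∞} {β : ℝ} (h : ENNReal.ofReal β < 2 * s) :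
    ¬ 2 * s * ENNReal.ofReal (1 / 2) < ENNReal.ofReal (β / 2) := by
  rw [not_lt, div_eq_mul_one_div, ENNReal.ofReal_mul' (by norm_num)]
  gcongr

/-- The multiplier always has a limit at infinity: 0 if `θ > 0`, and `e^{iσ}` if `θ = 0`. -/
lemma IsHighPass.boundedMultiplier_two {χ : ℝ → ℂ} (hχ : IsHighPass χ) {θ β : ℝ} (hθ : 0 ≤ θ)
    (hβ : 0 < β) (σ : ℝ) : BoundedMultiplier μ X 2 (genMult χ θ β σ) := by
  rcases hθ.eq_or_lt with rfl | hθ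
  · refine OscMult.boundedMultiplier_two (c := Complex.exp (Complex.I * σ))
      (hχ.continuous_genMult 0 β σ) (tendsto_const_nhds.congr' ?_)
    filter_upwards [hχ.one] with l hl
    rw [genMult_theta_zero, hl, mul_one]
  · exact OscMult.boundedMultiplier_two (hχ.continuous_genMult θ β σ)
      (hχ.tendsto_genMult (mul_pos hθ hβ) σ)

/-- Boundedness for `2 < p < ∞`, by duality. -/
lemma boundedMultiplier_of_two_lt [SigmaFinite μ] (hX : IsStratified X) {s : ℝ≥0}
    (h : HasL1Estimate μ X s) {θ β p : ℝ} (hθ : 0 ≤ θ) (hβ : 0 < β) (hp : 2 < p)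
    (hs : s * (1 - 2 / p) < β / 2) {χ : ℝ → ℂ} (hχ : IsHighPass χ) :
    BoundedMultiplier μ X (ENNReal.ofReal p) (genMult χ θ β 1) := by
  have hpq : p.HolderConjugate p.conjExponent := Real.HolderConjugate.conjExponent (by linarith)
  have hinv := hpq.symm.inv_add_inv_eq_one
  have hpinv : p⁻¹ < 2⁻¹ := inv_strictAnti₀ two_pos hp
  have hq2 : p.conjExponent < 2 := by
    rw [← inv_lt_inv₀ two_pos hpq.symm.pos]
    linarith
  refine BoundedMultiplier.of_conj hpq.symm ?_
  -- Conjugation reverses the sign of the phase and conjugates `χ`, which is why the case `p < 2`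
  -- allows `σ = ±1` and complex cutoffs.
  simp_rw [conj_genMult]
  refine boundedMultiplier_of_lt_two hX h hθ hβ hpq.symm.lt hq2 ?_ (by simp) hχ.conj
  convert hs using 2
  rw [div_eq_mul_inv, div_eq_mul_inv]
  linarith

end Final

end OscMult

theorem lemma1p2 {E : Type*} [NormedAddCommGroup E] [NormedSpace ℝ E] [FiniteDimensional ℝ E]
    {G : Type*} [TopologicalSpace G] [T2Space G] [SecondCountableTopology G] [ConnectedSpace G]
    [ChartedSpace E G] [Group G] [LieGroup 𝓘(ℝ, E) ∞ G]
    [MeasurableSpace G] [BorelSpace G]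
    (μ : Measure G) [μ.IsMulRightInvariant] [IsFiniteMeasureOnCompacts μ] [μ.IsOpenPosMeasure]
    {n : ℕ} (X : Fin n → GroupLieAlgebra 𝓘(ℝ, E) G) (hX : OscMult.IsStratified X)
    (χ : ℝ → ℂ) (hχ : ContDiff ℝ ∞ χ) (hχ₀ : ∀ l ≤ 1, χ l = 0) (hχ₁ : ∀ᶠ l in atTop, χ l = 1)
    (θ β : ℝ) (hθ : 0 ≤ θ) (hβ : 0 ≤ β)
    (hβs : ENNReal.ofReal β < 2 * OscMult.sPlus μ X)
    (p : ℝ≥0∞) (hp : 1 ≤ p)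
    (hps : 2 * OscMult.sPlus μ X * ENNReal.ofReal |(1 / p).toReal - 1 / 2| <
      ENNReal.ofReal (β / 2)) :
    OscMult.multiplierNorm μ X p (OscMult.oscMultiplier χ θ β) < (⊤ : ℝ≥0∞) := by
  have hβ0 : 0 < β := by
    have := ENNReal.ofReal_pos.1 (pos_of_gt hps)
    linarith
  have hχ' : OscMult.IsHighPass χ := ⟨hχ, hχ₀, hχ₁⟩
  have : LocallyCompactSpace G := Manifold.locallyCompact_of_finiteDimensional 𝓘(ℝ, E)
  suffices h : OscMult.BoundedMultiplier μ X p (OscMult.genMult χ θ β 1) from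
    (h.congr fun l hl => OscMult.genMult_eq_oscMultiplier χ θ β hl).multiplierNorm_lt_top
  -- At `p = ∞` and at `p = 1` the distance to `1/2` is `1/2`, and the hypothesis on `p` would
  -- contradict `β < 2 𝔰₊`.
  have hp_top : p ≠ ⊤ := by
    rintro rfl
    refine OscMult.not_two_mul_half_lt hβs (lt_of_eq_of_lt ?_ hps)
    norm_num [abs_of_pos]
  have hp_one : p ≠ 1 := by
    rintro rfl
    refine OscMult.not_two_mul_half_lt hβs (lt_of_eq_of_lt ?_ hps)
    norm_num [abs_of_pos]
  lift p to ℝ≥0 using hp_top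
  rw [show (1 / (p : ℝ≥0∞)).toReal = 1 / (p : ℝ) by simp] at hps
  have hp1 : (1 : ℝ) < p := by
    have h := hp.lt_of_ne' hp_one
    exact_mod_cast h
  rw [← ENNReal.ofReal_coe_nnreal]
  rcases lt_trichotomy (p : ℝ) 2 with h2 | h2 | h2
  · have hd : 0 < 1 / (p : ℝ) - 1 / 2 := sub_pos.2 (one_div_lt_one_div_of_lt (by linarith) h2)
    rw [abs_of_pos hd] at hps
    obtain ⟨s, hs, hs'⟩ := OscMult.exists_hasL1Estimate_of_lt hd hps
    refine OscMult.boundedMultiplier_of_lt_two hX hs hθ hβ0 hp1 h2 ?_ (by simp) hχ'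
    convert hs' using 2
    ring
  · rw [h2, ENNReal.ofReal_ofNat]
    exact hχ'.boundedMultiplier_two hθ hβ0 1
  · have hd : 0 < 1 / 2 - 1 / (p : ℝ) := sub_pos.2 (one_div_lt_one_div_of_lt (by linarith) h2)
    rw [abs_sub_comm, abs_of_pos hd] at hps
    obtain ⟨s, hs, hs'⟩ := OscMult.exists_hasL1Estimate_of_lt hd hps
    refine OscMult.boundedMultiplier_of_two_lt hX hs hθ hβ0 h2 ?_ hχ'
    convert hs' using 2
    ring
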